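/- Manifolds are finite-dimensional, Hausdorff, second countable and without boundary, and everything is smooth ($C^\infty$). Let $M$ be an $m$-dimensional manifold and $LM\to M$ its bundle of linear frames, a principal bundle with structure group $\mathrm{GL}(m,\mathbb R)$, whose elements over $x$ are the linear isomorphisms $u:\mathbb R^m\to T_xM$. Let $P(M,G)$ be a classical $G$-structure, that is, a principal bundle $\pi:P\to M$ with structure group a Lie group $G$, together with an injective Lie group homomorphism $f:G\to\mathrm{GL}(m,\mathbb R)$ and a smooth map $i:P\to LM$ over $\mathrm{id}_M$ with $i(u\cdot a)=i(u)\cdot f(a)$, such that $G$ is a reductive Lie subgroup: $\mathfrak{gl}(m,\mathbb R)=f_*\mathfrak g\oplus\mathfrak m$ for a (fixed) linear subspace $\mathfrak m$ with $\mathrm{Ad}_{f(a)}\mathfrak m\subset\mathfrak m$ for all $a\in G$. For $q\in LM$ let $\mathcal M_q\subset T_qLM$ be the space of the values at $q$ of the fundamental vector fields $A^*$, $A\in\mathfrak m$, where $A^*_q$ is the image of $A$ under the derivative at the identity of $a\mapsto q\cdot a$. Let $\rho:\Gamma\to G$ be a surjective homomorphism of Lie groups whose kernel is discrete and contained in the centre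 of $\Gamma$, and let $\zeta:\tilde P\to P$ be a $\Gamma$-structure on $P$, that is, $\tilde P$ is a principal bundle over $M$ with structure group $\Gamma$, and $\zeta$ is a smooth map over $\mathrm{id}_M$ with $\zeta(\tilde u\cdot\alpha)=\zeta(\tilde u)\cdot\rho(\alpha)$ for all $\tilde u\in\tilde P$, $\alpha\in\Gamma$. (For example $G=\mathrm{SO}(p,q)^e$, $P=\mathrm{SO}(M,g)$, $\Gamma=\mathrm{Spin}(p,q)^e$, $\tilde P=\mathrm{Spin}(M,g)$.) Let $\xi$ be any vector field on $M$, with flow $\varphi_t$, and let $L\xi$ be its natural lift to $LM$, $(L\xi)(u)=\frac{d}{dt}\big|_{t=0}\,T\varphi_t\circ u$. Then: (1) there is exactly one section $\xi_{\mathrm K}$ of $TP$ (the generalized Kosmann lift of $\xi$) such that $(L\xi)(i(u))-T_ui(\xi_{\mathrm K}(u))\in\mathcal M_{i(u)}$ for all $u\in P$; it is a smooth $G$-invariant vector field on $P$ that projects onto $\xi$; (2) there is a smooth vector field $\tilde\xi_{\mathrm K}$ on $\tilde P$ that projects onto $\xi_{\mathrm K}$, i.e. $T\zeta\circ\tilde\xi_{\mathrm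 K}=\xi_{\mathrm K}\circ\zeta$; it is $\Gamma$-invariant, and it is the only section of $T\tilde P$ that projects onto $\xi_{\mathrm K}$. -/

import Mathlib

open scoped Manifold ContDiff RightActions Topology
open Bundle Set

noncomputable section

/-! ### Principal bundles, right actions being actions of the opposite group -/

section General

variable {EM HM EG HG EP HP : Type*}
  [NormedAddCommGroup EM] [NormedSpace ℝ EM] [TopologicalSpace HM]
  [NormedAddCommGroup EG] [NormedSpace ℝ EG] [TopologicalSpace HG]
  [NormedAddCommGroup EP] [NormedSpace ℝ EP] [TopologicalSpace HP]

/-- `pr : P → M` is a smooth principal bundle with structure group `G` acting on the right on `P`: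
the action is smooth and free, `pr` is a smooth map that identifies `M` with the set of orbits,
and `P` is locally trivial through equivariant diffeomorphisms `pr ⁻¹ U ≃ U × G` over `U`. -/
structure IsPrincipalBundle (IM : ModelWithCorners ℝ EM HM) (IG : ModelWithCorners ℝ EG HG)
    (IP : ModelWithCorners ℝ EP HP) {M : Type*} [TopologicalSpace M] [ChartedSpace HM M]
    (G : Type*) [TopologicalSpace G] [ChartedSpace HG G] [Group G]
    {P : Type*} [TopologicalSpace P] [ChartedSpace HP P] [MulAction Gᵐᵒᵖ P]
    (pr : P → M) : Prop where
  smooth_action : ContMDiff (IP.prod IG) IP ∞ (fun p : P × G => p.1 <• p.2)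
  free : ∀ (u : P) (a : G), u <• a = u → a = 1
  smooth_proj : ContMDiff IP IM ∞ pr
  surjective_proj : Function.Surjective pr
  proj_eq_iff : ∀ u v : P, pr u = pr v ↔ ∃ a : G, v = u <• a
  locally_trivial : ∀ x : M, ∃ U : Set M, IsOpen U ∧ x ∈ U ∧
    ∃ Φ : OpenPartialHomeomorph P (M × G),
      Φ.source = pr ⁻¹' U ∧ Φ.target = U ×ˢ (univ : Set G) ∧
      ContMDiffOn IP (IM.prod IG) ∞ Φ Φ.source ∧
      ContMDiffOn (IM.prod IG) IP ∞ Φ.symm Φ.target ∧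
      ∀ u ∈ Φ.source, (Φ u).1 = pr u ∧ ∀ a : G, (Φ (u <• a)).2 = (Φ u).2 * a

variable {EG' HG' EP' HP' : Type*}
  [NormedAddCommGroup EG'] [NormedSpace ℝ EG'] [TopologicalSpace HG']
  [NormedAddCommGroup EP'] [NormedSpace ℝ EP'] [TopologicalSpace HP']

/-- A homomorphism, over the identity of the common base, from the bundle `pr' : P' → M` with
group `G'` to the bundle `pr : P → M` with group `G`: a smooth map `Φ : P' → P` over `M` that is
equivariant with respect to the Lie group homomorphism `f : G' → G`. -/
structure IsPrincipalHom (IG' : ModelWithCorners ℝ EG' HG') (IP' : ModelWithCorners ℝ EP' HP')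
    (IG : ModelWithCorners ℝ EG HG) (IP : ModelWithCorners ℝ EP HP) {M : Type*}
    {G' : Type*} [TopologicalSpace G'] [ChartedSpace HG' G'] [Group G']
    {P' : Type*} [TopologicalSpace P'] [ChartedSpace HP' P'] [MulAction G'ᵐᵒᵖ P']
    {G : Type*} [TopologicalSpace G] [ChartedSpace HG G] [Group G]
    {P : Type*} [TopologicalSpace P] [ChartedSpace HP P] [MulAction Gᵐᵒᵖ P]
    (pr' : P' → M) (pr : P → M) (f : G' →* G) (Φ : P' → P) : Prop where
  smooth_group : ContMDiff IG' IG ∞ f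
  smooth : ContMDiff IP' IP ∞ Φ
  equivariant : ∀ (u : P') (a : G'), Φ (u <• a) = Φ u <• f a
  proj_comp : ∀ u : P', pr (Φ u) = pr' u

/-- `P'` is, through `i` and `f`, a reduced subbundle of `P`. -/
structure IsReduction (IG' : ModelWithCorners ℝ EG' HG') (IP' : ModelWithCorners ℝ EP' HP')
    (IG : ModelWithCorners ℝ EG HG) (IP : ModelWithCorners ℝ EP HP) {M : Type*}
    {G' : Type*} [TopologicalSpace G'] [ChartedSpace HG' G'] [Group G']
    {P' : Type*} [TopologicalSpace P'] [ChartedSpace HP' P'] [MulAction G'ᵐᵒᵖ P']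
    {G : Type*} [TopologicalSpace G] [ChartedSpace HG G] [Group G]
    {P : Type*} [TopologicalSpace P] [ChartedSpace HP P] [MulAction Gᵐᵒᵖ P]
    (pr' : P' → M) (pr : P → M) (f : G' →* G) (i : P' → P) : Prop
    extends IsPrincipalHom IG' IP' IG IP pr' pr f i where
  injective_group : Function.Injective f

/-- `ζ : P' → P` is a `Γ`-structure on `P` over the central homomorphism `ρ` of `Γ` onto `G`. -/
structure IsGammaStructure (IΓ : ModelWithCorners ℝ EG' HG') (IP' : ModelWithCorners ℝ EP' HP')
    (IG : ModelWithCorners ℝ EG HG) (IP : ModelWithCorners ℝ EP HP) {M : Type*}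
    {Γ : Type*} [TopologicalSpace Γ] [ChartedSpace HG' Γ] [Group Γ]
    {P' : Type*} [TopologicalSpace P'] [ChartedSpace HP' P'] [MulAction Γᵐᵒᵖ P']
    {G : Type*} [TopologicalSpace G] [ChartedSpace HG G] [Group G]
    {P : Type*} [TopologicalSpace P] [ChartedSpace HP P] [MulAction Gᵐᵒᵖ P]
    (pr' : P' → M) (pr : P → M) (ρ : Γ →* G) (ζ : P' → P) : Prop
    extends IsPrincipalHom IΓ IP' IG IP pr' pr ρ ζ where
  surjective_group : Function.Surjective ρ
  discrete_ker : DiscreteTopology ρ.ker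
  ker_le_center : ρ.ker ≤ Subgroup.center Γ

/-! ### Vector fields -/

/-- A smooth vector field. -/
def IsSmoothVectorField (IM : ModelWithCorners ℝ EM HM) {M : Type*} [TopologicalSpace M]
    [ChartedSpace HM M] [IsManifold IM ∞ M] (X : (x : M) → TangentSpace IM x) : Prop :=
  ContMDiff IM IM.tangent ∞ (fun x => (⟨x, X x⟩ : TangentBundle IM M))

/-- `X` is invariant under the right action of `G` on `P`. -/
def IsInvariantVectorField (IP : ModelWithCorners ℝ EP HP) (G : Type*) [Group G]
    {P : Type*} [TopologicalSpace P] [ChartedSpace HP P] [MulAction Gᵐᵒᵖ P]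
    (X : (u : P) → TangentSpace IP u) : Prop :=
  ∀ (a : G) (u : P), mfderiv IP IP (fun v : P => v <• a) u (X u) = X (u <• a)

/-- `X'` on `P'` projects onto `X` on `P` along `ζ`. -/
def ProjectsOnto (IP' : ModelWithCorners ℝ EP' HP') (IP : ModelWithCorners ℝ EP HP)
    {P' : Type*} [TopologicalSpace P'] [ChartedSpace HP' P']
    {P : Type*} [TopologicalSpace P] [ChartedSpace HP P] (ζ : P' → P)
    (X' : (u : P') → TangentSpace IP' u) (X : (u : P) → TangentSpace IP u) : Prop :=
  ∀ u : P', mfderiv IP' IP ζ u (X' u) = X (ζ u)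

open Classical in
/-- The flow of `X`: `vectorFlow IM X t x` is the value at time `t` of the integral curve of `X`
starting at `x`, if such a curve exists up to time `t` (the value `x` is a dummy otherwise). -/
def vectorFlow (IM : ModelWithCorners ℝ EM HM) {M : Type*} [TopologicalSpace M]
    [ChartedSpace HM M] (X : (x : M) → TangentSpace IM x) (t : ℝ) (x : M) : M :=
  if h : ∃ γ : ℝ → M, γ 0 = x ∧ ∃ a b : ℝ, 0 ∈ Ioo a b ∧ t ∈ Ioo a b ∧
      IsMIntegralCurveOn (I := IM) γ X (Ioo a b)
  then h.choose t else x

/-! ### Reductive subgroups and the transverse bundle -/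

/-- The adjoint representation: the derivative at `1` of `x ↦ a * x * a⁻¹`. -/
def lieAd (IG : ModelWithCorners ℝ EG HG) {G : Type*} [TopologicalSpace G] [ChartedSpace HG G]
    [Group G] (a : G) : GroupLieAlgebra IG G →L[ℝ] GroupLieAlgebra IG G :=
  (mfderiv IG IG (fun x : G => a * x * a⁻¹) 1 : EG →L[ℝ] EG)

/-- The derivative at `1` of a homomorphism of Lie groups. -/
def lieMap (IG' : ModelWithCorners ℝ EG' HG') (IG : ModelWithCorners ℝ EG HG)
    {G' : Type*} [TopologicalSpace G'] [ChartedSpace HG' G'] [Group G']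
    {G : Type*} [TopologicalSpace G] [ChartedSpace HG G] [Group G]
    (f : G' →* G) : GroupLieAlgebra IG' G' →L[ℝ] GroupLieAlgebra IG G :=
  (mfderiv IG' IG f 1 : EG' →L[ℝ] EG)

/-- The Lie algebra of `G` is the direct sum of that of its subgroup `G'`, embedded through `f`,
and of the subspace `𝔪`, which is invariant under the adjoint action of `G'`. -/
structure IsReductiveSplitting (IG' : ModelWithCorners ℝ EG' HG') (IG : ModelWithCorners ℝ EG HG)
    {G' : Type*} [TopologicalSpace G'] [ChartedSpace HG' G'] [Group G']
    {G : Type*} [TopologicalSpace G] [ChartedSpace HG G] [Group G]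
    (f : G' →* G) (𝔪 : Submodule ℝ (GroupLieAlgebra IG G)) : Prop where
  isCompl : IsCompl (LinearMap.range (lieMap IG' IG f).toLinearMap) 𝔪
  ad_mem : ∀ (a : G'), ∀ A ∈ 𝔪, lieAd IG (f a) A ∈ 𝔪

/-- The value at `u` of the fundamental vector field of an element of the Lie algebra of `G`:
the derivative at `1` of `a ↦ u <• a`. -/
def fundamentalVector (IG : ModelWithCorners ℝ EG HG) (IP : ModelWithCorners ℝ EP HP)
    {G : Type*} [TopologicalSpace G] [ChartedSpace HG G] [Group G]
    {P : Type*} [TopologicalSpace P] [ChartedSpace HP P] [MulAction Gᵐᵒᵖ P]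
    (u : P) : GroupLieAlgebra IG G →L[ℝ] TangentSpace IP u :=
  (mfderiv IG IP (fun a : G => u <• a) 1 : EG →L[ℝ] EP)

/-- The subspace of the vertical space at `u` that corresponds to `𝔪`. -/
def transverseSpace (IG : ModelWithCorners ℝ EG HG) (IP : ModelWithCorners ℝ EP HP)
    {G : Type*} [TopologicalSpace G] [ChartedSpace HG G] [Group G]
    {P : Type*} [TopologicalSpace P] [ChartedSpace HP P] [MulAction Gᵐᵒᵖ P]
    (𝔪 : Submodule ℝ (GroupLieAlgebra IG G)) (u : P) : Submodule ℝ (TangentSpace IP u) :=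
  𝔪.map (fundamentalVector IG IP (G := G) u).toLinearMap

/-- `ΞK` is the generalized Kosmann vector field of the vector field `Ξ` on `Q` for the reduction
`i : P → Q`: at each point of `P` it is the component of `Ξ` tangent to `P` in the decomposition
`T_u Q = T_u P ⊕ 𝓜_u`, with `𝓜_u` the transverse space of `𝔪`. -/
def IsKosmannField (IG : ModelWithCorners ℝ EG HG) (IP' : ModelWithCorners ℝ EP' HP')
    (IP : ModelWithCorners ℝ EP HP)
    {G : Type*} [TopologicalSpace G] [ChartedSpace HG G] [Group G]
    {P' : Type*} [TopologicalSpace P'] [ChartedSpace HP' P']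
    {Q : Type*} [TopologicalSpace Q] [ChartedSpace HP Q] [MulAction Gᵐᵒᵖ Q]
    (𝔪 : Submodule ℝ (GroupLieAlgebra IG G)) (i : P' → Q)
    (Ξ : (q : Q) → TangentSpace IP q) (ΞK : (u : P') → TangentSpace IP' u) : Prop :=
  ∀ u : P', Ξ (i u) - mfderiv IP' IP i u (ΞK u) ∈ transverseSpace IG IP 𝔪 (i u)

end General

/-! ### The bundle of linear frames -/

section Frames

/-- The model space `ℝ^m`. -/
abbrev RSpace (m : ℕ) : Type := EuclideanSpace ℝ (Fin m)

/-- The Lie group `GL(m, ℝ)`. -/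
abbrev GLGroup (m : ℕ) : Type := (RSpace m →L[ℝ] RSpace m)ˣ

/-- The model with corners of the Lie group `GL(m, ℝ)`, an open subset of the space of
endomorphisms. -/
abbrev glModel (m : ℕ) :
    ModelWithCorners ℝ (RSpace m →L[ℝ] RSpace m) (RSpace m →L[ℝ] RSpace m) :=
  𝓘(ℝ, RSpace m →L[ℝ] RSpace m)

/-- The total space of the vector bundle over `M` with fibres `Hom (ℝ^m, T_x M)`. -/
abbrev HomTangent (m : ℕ) (M : Type*) [TopologicalSpace M] [ChartedSpace (RSpace m) M]
    [IsManifold (𝓡 m) ∞ M] : Type _ :=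
  TotalSpace (RSpace m →L[ℝ] RSpace m)
    (fun x : M => Trivial M (RSpace m) x →L[ℝ] TangentSpace (𝓡 m) x)

variable (m : ℕ) (M : Type*) [TopologicalSpace M] [ChartedSpace (RSpace m) M]
  [IsManifold (𝓡 m) ∞ M]

theorem isOpen_setOf_isFrame : IsOpen {u : HomTangent m M | u.2.IsInvertible} := by
  rw [isOpen_iff_mem_nhds]
  intro u hu
  set e := trivializationAt (RSpace m →L[ℝ] RSpace m)
    (fun x : M => Trivial M (RSpace m) x →L[ℝ] TangentSpace (𝓡 m) x) u.1 with he
  have hbase : ∀ v : HomTangent m M, v ∈ e.source →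
      ((e v).2.IsInvertible ↔ v.2.IsInvertible) := by
    intro v hv
    have hv2 : v.1 ∈ (trivializationAt (RSpace m) (TangentSpace (𝓡 m)) u.1).baseSet := by
      rw [he, hom_trivializationAt_source] at hv
      exact hv.2
    have h1 : (e v).2 = ((trivializationAt (RSpace m) (TangentSpace (𝓡 m))
        u.1).continuousLinearEquivAt ℝ v.1 hv2 : _ →L[ℝ] RSpace m) ∘L v.2 := by
      rw [he, hom_trivializationAt_apply]
      refine ContinuousLinearMap.ext fun w => ?_
      simp [ContinuousLinearMap.inCoordinates, Trivialization.coe_linearMapAt_of_mem _ hv2]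
    rw [h1]
    exact ContinuousLinearMap.isInvertible_equiv_comp
  have hmem : u ∈ e.source := by
    rw [he]
    exact FiberBundle.mem_trivializationAt_proj_source
  have hopen : IsOpen (e.source ∩ (fun v => (e v).2) ⁻¹'
      (range ((↑) : (RSpace m ≃L[ℝ] RSpace m) → (RSpace m →L[ℝ] RSpace m)))) :=
    (continuous_snd.comp_continuousOn e.continuousOn).isOpen_inter_preimage e.open_source
      ContinuousLinearEquiv.isOpen
  refine Filter.mem_of_superset (hopen.mem_nhds ⟨hmem, (hbase u hmem).2 hu⟩) ?_
  rintro v ⟨hv, hv'⟩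
  exact (hbase v hv).1 hv'

/-- The bundle of linear frames of `M`, an open submanifold of the bundle of homomorphisms: a
frame at `x` is a linear isomorphism `ℝ^m → T_x M`. -/
def frameOpens : TopologicalSpace.Opens (HomTangent m M) :=
  ⟨{u | u.2.IsInvertible}, isOpen_setOf_isFrame m M⟩

abbrev FrameBundle : Type _ := frameOpens m M

/-- The model with corners of the frame bundle. -/
abbrev frameModel : ModelWithCorners ℝ (RSpace m × (RSpace m →L[ℝ] RSpace m))
    (ModelProd (RSpace m) (RSpace m →L[ℝ] RSpace m)) :=
  (𝓡 m).prod 𝓘(ℝ, RSpace m →L[ℝ] RSpace m)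

variable {m M}

/-- The base point of a frame. -/
def frameProj (u : FrameBundle m M) : M := u.1.1

/-- The linear isomorphism `ℝ^m → T_x M` that is the frame. -/
def frameMap (u : FrameBundle m M) : RSpace m →L[ℝ] TangentSpace (𝓡 m) (frameProj u) := u.1.2

/-- The right action of `GL(m, ℝ)` on frames by composition. -/
instance frameAction : MulAction (GLGroup m)ᵐᵒᵖ (FrameBundle m M) where
  smul g u := ⟨⟨frameProj u, frameMap u ∘L (g.unop : RSpace m →L[ℝ] RSpace m)⟩, by
    exact u.2.comp ⟨ContinuousLinearEquiv.unitsEquiv ℝ (RSpace m) g.unop, rfl⟩⟩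
  one_smul _ := rfl
  mul_smul _ _ _ := rfl

open Classical in
/-- The natural lift `L¹φ` of a map `φ` of `M`, taking a frame `u` at `x` to the frame
`T_x φ ∘ u` at `φ x` when `T_x φ` is invertible (the value `u` is a dummy otherwise). -/
def frameLift (φ : M → M) (u : FrameBundle m M) : FrameBundle m M :=
  if h : (mfderiv (𝓡 m) (𝓡 m) φ (frameProj u) ∘L frameMap u).IsInvertible then
    ⟨⟨φ (frameProj u), mfderiv (𝓡 m) (𝓡 m) φ (frameProj u) ∘L frameMap u⟩, h⟩
  else u

/-- The natural lift `Lξ` of a vector field `ξ` to the frame bundle: the derivative at `t = 0` of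
`L¹φ_t`, with `φ_t` the flow of `ξ`. -/
def naturalLift (ξ : (x : M) → TangentSpace (𝓡 m) x) (u : FrameBundle m M) :
    TangentSpace (frameModel m) u :=
  (mfderiv 𝓘(ℝ, ℝ) (frameModel m)
    (fun t : ℝ => frameLift (vectorFlow (𝓡 m) ξ t) u) 0 :
      ℝ →L[ℝ] RSpace m × (RSpace m →L[ℝ] RSpace m)) 1

end Frames

end

/-! For a principal bundle the vertical space is the image of the Lie algebra, so T_uP and T_qLM,
with q = i(u), are extensions of the same T_xM by 𝔤 and by 𝔤𝔩(m). The pair (f_*, T_u i) is a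
morphism of these extensions over the identity of T_xM. Diagram chasing (`eq_zero_of_extension_hom`,
`exists_eq_of_extension_hom`) turns the splitting 𝔤𝔩(m) = f_*𝔤 ⊕ 𝔪 into T_qLM = T_u i(T_uP) ⊕ 𝓜_q,
with T_u i and A ↦ A^*_q injective. Injectivity of f_* follows from that of f (`lieMap_injective`).
Hence ξ_K exists and is unique pointwise, with no regularity assumed of the competing sections.

The field ξ_K is smooth because the map (u, A) ↦ i(u)·σ(A), A ∈ 𝔪, with σ a parametrization of GL(m)
at 1, has invertible derivative along A = 0. Pulling Lξ back by it and taking the P-component gives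
ξ_K. Invariance follows from uniqueness, since right translation by f(a) preserves Lξ and takes A^*
to (Ad_{f(a)⁻¹} A)^*, which stays in 𝓜. As 𝓜 is vertical, ξ_K projects to ξ just as Lξ does.

What this needs of Lξ is smoothness, GL(m)-invariance and projection onto ξ. Smoothness and
projection are read off the coordinate formula Lξ(x, p) = (v(x), Dv(x)∘p), v being ξ in a chart
(`hasMFDerivAt_frameLift_vectorFlow`). The formula rests on differentiating a flow in its initial
point (`hasFDerivAt_flow`).

For (2), ρ_* is injective because ker ρ is discrete, and a smooth surjection from a second countable
manifold cannot raise dimension, so ρ_* is bijective (`lieMap_bijective`). The same diagram chase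
with 𝔪 = 0 makes every T_uζ bijective, so ξ_K has exactly one lift, its pullback. -/

noncomputable section

/-! ### Differentiability of a local flow in the initial point -/

section ODE

variable {E : Type*} [NormedAddCommGroup E] [NormedSpace ℝ E]

/-- Gronwall forward in time, applied to `f` or, for negative `t`, to `s ↦ f (-s)`. -/
theorem norm_le_gronwallBound_abs {f f' : ℝ → E} {K η T : ℝ}
    (hf : ∀ t ∈ Icc (-T) T, HasDerivAt f (f' t) t) (h0 : f 0 = 0)
    (hbound : ∀ t ∈ Icc (-T) T, ‖f' t‖ ≤ K * ‖f t‖ + η) {t : ℝ} (ht : |t| ≤ T) :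
    ‖f t‖ ≤ gronwallBound 0 K η |t| := by
  have key : ∀ (g g' : ℝ → E) (b : ℝ), 0 ≤ b → (∀ s ∈ Icc 0 b, HasDerivAt g (g' s) s) → g 0 = 0 →
      (∀ s ∈ Icc 0 b, ‖g' s‖ ≤ K * ‖g s‖ + η) → ‖g b‖ ≤ gronwallBound 0 K η b := by
    intro g g' b hb hg hg0 hgb
    have := norm_le_gronwallBound_of_norm_deriv_right_le (f := g) (f' := g') (δ := 0) (K := K)
      (ε := η) (a := 0) (b := b) (fun s hs => (hg s hs).continuousAt.continuousWithinAt)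
      (fun s hs => (hg s (Ico_subset_Icc_self hs)).hasDerivWithinAt) (by simp [hg0])
      (fun s hs => hgb s (Ico_subset_Icc_self hs)) b ⟨hb, le_rfl⟩
    simpa using this
  obtain ⟨h1, h2⟩ := abs_le.1 ht
  rcases le_total 0 t with h | h
  · rw [abs_of_nonneg h]
    exact key f f' t h (fun s hs => hf s ⟨by linarith [hs.1], by linarith [hs.2]⟩) h0
      (fun s hs => hbound s ⟨by linarith [hs.1], by linarith [hs.2]⟩)
  · rw [abs_of_nonpos h]
    have := key (fun s => f (-s)) (fun s => -f' (-s)) (-t) (by linarith) (fun s hs => by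
        have := (hf (-s) ⟨by linarith [hs.1, hs.2], by linarith [hs.1, hs.2]⟩).scomp s
          (hasDerivAt_neg s)
        simpa [Function.comp_def] using this) (by simpa using h0)
      (fun s hs => by
        simpa using hbound (-s) ⟨by linarith [hs.1, hs.2], by linarith [hs.1, hs.2]⟩)
    simpa using this

/-- Along a compact piece of a curve, a `C¹` map is uniformly strictly differentiable. -/
theorem exists_uniform_linear_approx {v : E → E} {s K : Set E} (hs : IsOpen s)
    (hv : ContDiffOn ℝ 1 v s) (hK : IsCompact K) (hKs : K ⊆ s) {η : ℝ} (hη : 0 < η) :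
    ∃ ρ > 0, ∀ x ∈ K, ∀ y, dist y x < ρ → ‖v y - v x - fderiv ℝ v x (y - x)‖ ≤ η * ‖y - x‖ := by
  have hc : ContinuousOn (fderiv ℝ v) s := hv.continuousOn_fderiv_of_isOpen hs le_rfl
  have h1 := hK.uniformContinuousAt_of_continuousAt (fderiv ℝ v)
    (fun x hx => hc.continuousAt (hs.mem_nhds (hKs hx))) (Metric.dist_mem_uniformity hη)
  obtain ⟨ρ₁, hρ₁, h1⟩ := Metric.mem_uniformity_dist.1 h1
  obtain ⟨ρ₂, hρ₂, h2⟩ := hK.exists_thickening_subset_open hs hKs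
  -- `ρ₂` keeps the ball inside `s`, and `ρ₁` keeps the derivative within `η` of its value at `x`.
  -- The mean value inequality on the convex ball does the rest.
  refine ⟨min ρ₁ ρ₂, lt_min hρ₁ hρ₂, fun x hx y hy => ?_⟩
  have hmem : ∀ z ∈ Metric.ball x (min ρ₁ ρ₂), z ∈ s := fun z hz =>
    h2 (Metric.mem_thickening_iff.2 ⟨x, hx, lt_of_lt_of_le hz (min_le_right _ _)⟩)
  refine (convex_ball x (min ρ₁ ρ₂)).norm_image_sub_le_of_norm_hasFDerivWithin_le'
    (f' := fderiv ℝ v) (φ := fderiv ℝ v x) (fun z hz => ?_) (fun z hz => ?_)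
    (Metric.mem_ball_self (lt_min hρ₁ hρ₂)) hy
  · exact ((hv.contDiffAt (hs.mem_nhds (hmem z hz))).differentiableAt
      one_ne_zero).hasFDerivAt.hasFDerivWithinAt
  · have := h1 (a := x) (b := z) (by
      rw [dist_comm]; exact lt_of_lt_of_le hz (min_le_left _ _)) hx
    rw [← dist_eq_norm, dist_comm]
    exact (le_of_lt this)

/-- A local flow, Lipschitz in the initial point, is differentiable in the initial point, the
derivative being the solution of the linearized equation. -/
theorem hasFDerivAt_flow {v : E → E} {s : Set E} (hs : IsOpen s) (hv : ContDiffOn ℝ 1 v s)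
    {x₀ : E} {ε r : ℝ} (hr : 0 < r) {α : E → ℝ → E} {A : ℝ → E →L[ℝ] E} {L : NNReal}
    (hα0 : ∀ y ∈ Metric.ball x₀ r, α y 0 = y)
    (hα : ∀ y ∈ Metric.ball x₀ r, ∀ t ∈ Ioo (-ε) ε, HasDerivAt (α y) (v (α y t)) t)
    (hL : ∀ t ∈ Ioo (-ε) ε, LipschitzOnWith L (fun y => α y t) (Metric.ball x₀ r))
    (hαs : ∀ t ∈ Ioo (-ε) ε, α x₀ t ∈ s)
    (hA0 : A 0 = ContinuousLinearMap.id ℝ E)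
    (hA : ∀ t ∈ Ioo (-ε) ε, HasDerivAt A (fderiv ℝ v (α x₀ t) ∘L A t) t)
    {t : ℝ} (ht : t ∈ Ioo (-ε) ε) : HasFDerivAt (fun y => α y t) (A t) x₀ := by
  set T := |t| with hT
  have hTε : T < ε := abs_lt.2 ⟨by linarith [ht.1], ht.2⟩
  have hIcc : ∀ τ ∈ Icc (-T) T, τ ∈ Ioo (-ε) ε := fun τ hτ =>
    ⟨by linarith [hτ.1], by linarith [hτ.2]⟩
  have hx₀ : x₀ ∈ Metric.ball x₀ r := Metric.mem_ball_self hr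
  have hcont : ContinuousOn (α x₀) (Icc (-T) T) := fun τ hτ =>
    (hα x₀ hx₀ τ (hIcc τ hτ)).continuousAt.continuousWithinAt
  have hKc : IsCompact (α x₀ '' Icc (-T) T) := isCompact_Icc.image_of_continuousOn hcont
  have hKs : α x₀ '' Icc (-T) T ⊆ s := by
    rintro _ ⟨τ, hτ, rfl⟩; exact hαs τ (hIcc τ hτ)
  obtain ⟨C, hC⟩ := hKc.exists_bound_of_continuousOn
    ((hv.continuousOn_fderiv_of_isOpen hs le_rfl).mono hKs)
  -- Any bound of the derivative along the curve would do; the 1 makes `K` nonzero, as the closed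
  -- form of `gronwallBound` requires.
  set K := max C 1 with hKdef
  have hK1 : 1 ≤ K := le_max_right _ _
  rw [hasFDerivAt_iff_isLittleO, Asymptotics.isLittleO_iff]
  intro c hc
  set B := (Real.exp (K * T) - 1) / K with hB
  have hB0 : 0 ≤ B := div_nonneg (sub_nonneg.2 (Real.one_le_exp (by positivity))) (by linarith)
  -- Gronwall will bound the error by `η * L * B * ‖y - x₀‖`, which this choice keeps below `c * ‖y
  -- - x₀‖`. The added ones avoid division by zero.
  set η := c / ((L + 1) * (B + 1)) with hη
  have hη0 : 0 < η := by positivity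
  obtain ⟨ρ, hρ, happ⟩ := exists_uniform_linear_approx hs hv hKc hKs hη0
  have hball : Metric.ball x₀ (min r (ρ / (L + 1))) ∈ 𝓝 x₀ := Metric.ball_mem_nhds _ (by positivity)
  filter_upwards [hball] with y hy
  have hyr : y ∈ Metric.ball x₀ r := Metric.ball_subset_ball (min_le_left _ _) hy
  have hyρ : dist y x₀ < ρ / (L + 1) := lt_of_lt_of_le hy (min_le_right _ _)
  have hdist : ∀ τ ∈ Icc (-T) T, dist (α y τ) (α x₀ τ) ≤ L * dist y x₀ := fun τ hτ =>
    (hL τ (hIcc τ hτ)).dist_le_mul y hyr x₀ hx₀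
  have hsmall : ∀ τ ∈ Icc (-T) T, dist (α y τ) (α x₀ τ) < ρ := fun τ hτ => by
    refine lt_of_le_of_lt (hdist τ hτ) ?_
    rw [lt_div_iff₀ (by positivity)] at hyρ
    nlinarith [dist_nonneg (x := y) (y := x₀)]
  -- The error of the linear approximation solves the linearized equation up to a remainder, which
  -- is at most `η` times the distance of the two curves, hence at most `η * L * ‖y - x₀‖`.
  have hgr := norm_le_gronwallBound_abs (K := K) (η := η * (L * ‖y - x₀‖)) (T := T) (t := t)
    (f := fun τ => α y τ - α x₀ τ - A τ (y - x₀))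
    (f' := fun τ => v (α y τ) - v (α x₀ τ) - fderiv ℝ v (α x₀ τ) (A τ (y - x₀)))
    (fun τ hτ => ((hα y hyr τ (hIcc τ hτ)).sub (hα x₀ hx₀ τ (hIcc τ hτ))).sub
      ((hA τ (hIcc τ hτ)).clm_apply (hasDerivAt_const τ (y - x₀)) |>.congr_deriv (by simp)))
    (by simp [hα0 y hyr, hα0 x₀ hx₀, hA0])
    (fun τ hτ => by
      have h1 := happ (α x₀ τ) ⟨τ, hτ, rfl⟩ (α y τ) (hsmall τ hτ)
      have h2 : ‖fderiv ℝ v (α x₀ τ) (α y τ - α x₀ τ - A τ (y - x₀))‖ ≤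
          K * ‖α y τ - α x₀ τ - A τ (y - x₀)‖ :=
        (ContinuousLinearMap.le_opNorm _ _).trans (mul_le_mul_of_nonneg_right
          ((hC _ ⟨τ, hτ, rfl⟩).trans (le_max_left _ _)) (norm_nonneg _))
      have h3 : ‖α y τ - α x₀ τ‖ ≤ L * ‖y - x₀‖ := by
        simpa [dist_eq_norm] using hdist τ hτ
      calc ‖v (α y τ) - v (α x₀ τ) - fderiv ℝ v (α x₀ τ) (A τ (y - x₀))‖
          = ‖fderiv ℝ v (α x₀ τ) (α y τ - α x₀ τ - A τ (y - x₀)) +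
            (v (α y τ) - v (α x₀ τ) - fderiv ℝ v (α x₀ τ) (α y τ - α x₀ τ))‖ := by
              congr 1; simp only [map_sub]; abel
        _ ≤ _ := (norm_add_le _ _).trans (add_le_add h2 (h1.trans
              (mul_le_mul_of_nonneg_left h3 hη0.le)))) le_rfl
  have hK0 : K ≠ 0 := by positivity
  rw [gronwallBound_of_K_ne_0 hK0, ← hT] at hgr
  simp only [zero_mul, zero_add] at hgr
  refine hgr.trans ?_
  have : η * (L * ‖y - x₀‖) / K * (Real.exp (K * T) - 1) = η * L * B * ‖y - x₀‖ := by
    rw [hB]; ring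
  rw [this]
  refine mul_le_mul_of_nonneg_right ?_ (norm_nonneg _)
  have hL0 : (0 : ℝ) ≤ L := L.2
  have h5 : η * ((L + 1) * (B + 1)) = c := by rw [hη]; field_simp
  rw [← h5, mul_assoc]
  refine mul_le_mul_of_nonneg_left ?_ hη0.le
  nlinarith

/-- A `C²` vector field has near each point a local flow that is differentiable in the initial
point, with derivative `A t` such that `A' 0` is the derivative of the field. -/
theorem exists_local_flow_hasFDerivAt [CompleteSpace E] {v : E → E} {s : Set E} (hs : IsOpen s)
    (hv : ContDiffOn ℝ 2 v s) {x₀ : E} (hx₀ : x₀ ∈ s) :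
    ∃ δ > 0, ∃ ε > 0, ∃ (α : E → ℝ → E) (A : ℝ → E →L[ℝ] E),
      (∀ y ∈ Metric.ball x₀ δ, α y 0 = y ∧
        ∀ t ∈ Ioo (-ε) ε, α y t ∈ s ∧ HasDerivAt (α y) (v (α y t)) t) ∧
      (∀ t ∈ Ioo (-ε) ε, HasFDerivAt (fun y => α y t) (A t) x₀) ∧
      A 0 = ContinuousLinearMap.id ℝ E ∧ HasDerivAt A (fderiv ℝ v x₀) 0 := by
  have hv1 : ContDiffOn ℝ 1 v s := hv.of_le (by norm_num)
  obtain ⟨ε₁, hε₁, a, r, L, K, hr, hpl⟩ := IsPicardLindelof.of_contDiffAt_one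
    (hv1.contDiffAt (hs.mem_nhds hx₀))
  obtain ⟨α, hα, L', hL'⟩ :=
    (hpl 0).exists_forall_mem_closedBall_eq_hasDerivWithinAt_lipschitzOnWith
  simp only [zero_sub, zero_add] at hα hL'
  -- The flow and its linearization are one autonomous system, of class C¹ since `v` is C². Its
  -- solution from `(x₀, id)` has the desired `A` as second component.
  have hw : ContDiffAt ℝ 1 (fun p : E × (E →L[ℝ] E) => (v p.1, fderiv ℝ v p.1 ∘L p.2))
      (x₀, ContinuousLinearMap.id ℝ E) := by
    have h1 : ContDiffAt ℝ 2 v x₀ := hv.contDiffAt (hs.mem_nhds hx₀)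
    have h2 : ContDiffAt ℝ 1 (fderiv ℝ v) x₀ := h1.fderiv_right (by norm_num)
    exact ((h1.of_le (by norm_num)).comp (x₀, ContinuousLinearMap.id ℝ E) contDiffAt_fst).prodMk
      ((h2.comp (x₀, ContinuousLinearMap.id ℝ E) contDiffAt_fst).clm_comp contDiffAt_snd)
  obtain ⟨β, hβ0, ε₂, hε₂, hβ⟩ :=
    hw.exists_forall_mem_closedBall_exists_eq_forall_mem_Ioo_hasDerivAt₀ 0
  simp only [zero_sub, zero_add] at hβ
  have hr' : (0 : ℝ) < r := hr
  have hder : ∀ y ∈ Metric.closedBall x₀ r, ∀ t ∈ Ioo (-ε₁) ε₁,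
      HasDerivAt (α y) (v (α y t)) t := fun y hy t ht =>
    ((hα y hy).2 t (Ioo_subset_Icc_self ht)).hasDerivAt (Icc_mem_nhds ht.1 ht.2)
  have hxr : x₀ ∈ Metric.closedBall x₀ r := Metric.mem_closedBall_self hr'.le
  obtain ⟨ρ, hρ, hρs⟩ := Metric.isOpen_iff.1 hs x₀ hx₀
  have h0 : (0 : ℝ) ∈ Ioo (-ε₁) ε₁ := ⟨by linarith, hε₁⟩
  have hnear : ∀ᶠ t in 𝓝 (0 : ℝ), dist (α x₀ t) x₀ < ρ / 2 := by
    have := (hder x₀ hxr 0 h0).continuousAt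
    have h := this.eventually (Metric.ball_mem_nhds (α x₀ 0) (half_pos hρ))
    rw [(hα x₀ hxr).1] at h
    exact h
  -- The first component of the augmented solution is an integral curve of `v` from `x₀`, so
  -- uniqueness identifies it with the Picard curve near 0.
  have hβx : ∀ᶠ t in 𝓝 (0 : ℝ), α x₀ t = (β t).1 := by
    obtain ⟨K', s', hs', hlip⟩ := (hv1.contDiffAt (hs.mem_nhds hx₀)).exists_lipschitzOnWith
    have hc1 := (hder x₀ hxr 0 h0).continuousAt
    have hd2 : ∀ t ∈ Ioo (-ε₂) ε₂, HasDerivAt (fun t => (β t).1) (v (β t).1) t := fun t ht =>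
      (hβ t ht).fst
    have hc2 := (hd2 0 ⟨by linarith, hε₂⟩).continuousAt
    refine ODE_solution_unique_of_eventually (v := fun _ => v) (s := fun _ => s') (K := K')
      (.of_forall fun _ => hlip) ?_ ?_ ?_
    · filter_upwards [Ioo_mem_nhds h0.1 h0.2, hc1.preimage_mem_nhds
        (by rw [(hα x₀ hxr).1]; exact hs')] with t ht ht'
      exact ⟨hder x₀ hxr t ht, ht'⟩
    · filter_upwards [Ioo_mem_nhds (neg_lt_zero.2 hε₂) hε₂, hc2.preimage_mem_nhds
        (by rw [hβ0]; exact hs')] with t ht ht'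
      exact ⟨hd2 t ht, ht'⟩
    · rw [(hα x₀ hxr).1, hβ0]
  obtain ⟨ε₃, hε₃, h3⟩ := Metric.eventually_nhds_iff_ball.1 (hnear.and hβx)
  rw [Real.ball_eq_Ioo, zero_sub, zero_add] at h3
  set ε := min ε₁ (min ε₂ ε₃) with hε
  have hεpos : 0 < ε := by positivity
  have e1 : ∀ t ∈ Ioo (-ε) ε, t ∈ Ioo (-ε₁) ε₁ := fun t ht =>
    ⟨by linarith [ht.1, min_le_left ε₁ (min ε₂ ε₃)], by linarith [ht.2, min_le_left ε₁ (min ε₂ ε₃)]⟩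
  have e2 : ∀ t ∈ Ioo (-ε) ε, t ∈ Ioo (-ε₂) ε₂ := fun t ht => by
    have := (min_le_right ε₁ (min ε₂ ε₃)).trans (min_le_left _ _)
    exact ⟨by linarith [ht.1], by linarith [ht.2]⟩
  have e3 : ∀ t ∈ Ioo (-ε) ε, t ∈ Ioo (-ε₃) ε₃ := fun t ht => by
    have := (min_le_right ε₁ (min ε₂ ε₃)).trans (min_le_right _ _)
    exact ⟨by linarith [ht.1], by linarith [ht.2]⟩
  -- The central curve moves by less than `ρ / 2`, and by the Lipschitz bound the others stay within
  -- `ρ / 2` of it, so all remain in `s`.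
  set δ := min (r : ℝ) (ρ / 2 / (L' + 1)) with hδ
  have hδpos : 0 < δ := by positivity
  have hcb : ∀ y ∈ Metric.ball x₀ δ, y ∈ Metric.closedBall x₀ r := fun y hy =>
    Metric.ball_subset_closedBall (Metric.ball_subset_ball (min_le_left _ _) hy)
  refine ⟨δ, hδpos, ε, hεpos, α, fun t => (β t).2, fun y hy => ⟨(hα y (hcb y hy)).1,
    fun t ht => ⟨?_, hder y (hcb y hy) t (e1 t ht)⟩⟩, fun t ht => ?_, by simp [hβ0], ?_⟩
  · apply hρs
    have h4 := (hL' t (Ioo_subset_Icc_self (e1 t ht))).dist_le_mul y (hcb y hy) x₀ hxr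
    have h5 : dist y x₀ < ρ / 2 / (L' + 1) := lt_of_lt_of_le hy (min_le_right _ _)
    rw [lt_div_iff₀ (by positivity)] at h5
    have h6 := (h3 t (e3 t ht)).1
    have h7 := dist_triangle (α y t) (α x₀ t) x₀
    rw [Metric.mem_ball]
    nlinarith [dist_nonneg (x := y) (y := x₀)]
  · refine hasFDerivAt_flow hs hv1 (A := fun t => (β t).2) (r := δ) hδpos (L := L') (ε := ε)
      (fun y hy => (hα y (hcb y hy)).1)
      (fun y hy t ht => hder y (hcb y hy) t (e1 t ht))
      (fun t ht => (hL' t (Ioo_subset_Icc_self (e1 t ht))).mono fun y hy => hcb y hy)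
      (fun t ht => hρs ?_) (congrArg Prod.snd hβ0) (fun t ht => ?_) ht
    · exact ((h3 t (e3 t ht)).1).trans (half_lt_self hρ)
    · rw [(h3 t (e3 t ht)).2]
      exact (hβ t (e2 t ht)).snd
  · have : HasDerivAt (fun t => (β t).2) (fderiv ℝ v (β 0).1 ∘L (β 0).2) 0 :=
      (hβ 0 ⟨by linarith, hε₂⟩).snd
    rw [hβ0] at this
    exact this

end ODE

/-! ### Tangent spaces of principal bundles as extensions by the Lie algebra -/

section PrincipalBundle

section Algebra

variable {G P : Type*} [Group G] [MulAction Gᵐᵒᵖ P]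

theorem rightSmul_one (u : P) : u <• (1 : G) = u := one_smul Gᵐᵒᵖ u

theorem rightSmul_mul (u : P) (a b : G) : u <• (a * b) = (u <• a) <• b := by
  rw [MulOpposite.op_mul, mul_smul]

end Algebra

variable {EM HM EG HG EP HP : Type*}
  [NormedAddCommGroup EM] [NormedSpace ℝ EM] [TopologicalSpace HM]
  [NormedAddCommGroup EG] [NormedSpace ℝ EG] [TopologicalSpace HG]
  [NormedAddCommGroup EP] [NormedSpace ℝ EP] [TopologicalSpace HP]
  {IM : ModelWithCorners ℝ EM HM} {IG : ModelWithCorners ℝ EG HG} {IP : ModelWithCorners ℝ EP HP}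
  {M : Type*} [TopologicalSpace M] [ChartedSpace HM M]
  {G : Type*} [TopologicalSpace G] [ChartedSpace HG G] [Group G]
  {P : Type*} [TopologicalSpace P] [ChartedSpace HP P] [MulAction Gᵐᵒᵖ P]
  {pr : P → M}

theorem contMDiff_orbitMap
    (hact : ContMDiff (IP.prod IG) IP ∞ (fun p : P × G => p.1 <• p.2)) (u : P) :
    ContMDiff IG IP ∞ (fun a : G => u <• a) :=
  hact.comp (contMDiff_const.prodMk contMDiff_id)

theorem contMDiff_rightTranslation
    (hact : ContMDiff (IP.prod IG) IP ∞ (fun p : P × G => p.1 <• p.2)) (a : G) :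
    ContMDiff IP IP ∞ (fun u : P => u <• a) :=
  hact.comp (contMDiff_id.prodMk contMDiff_const)

theorem hasMFDerivAt_orbitMap
    (hact : ContMDiff (IP.prod IG) IP ∞ (fun p : P × G => p.1 <• p.2)) (u : P) :
    HasMFDerivAt IG IP (fun a : G => u <• a) 1 (fundamentalVector IG IP (G := G) u) :=
  ((contMDiff_orbitMap hact u).mdifferentiable (by simp) 1).hasMFDerivAt

/-- Allows the chain rule at points such as `f 1` or `a⁻¹ * 1 * a⁻¹⁻¹`, which equal 1 only
propositionally. -/
theorem hasMFDerivAt_orbitMap_of_eq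
    (hact : ContMDiff (IP.prod IG) IP ∞ (fun p : P × G => p.1 <• p.2)) (u : P) {g : G}
    (hg : g = 1) :
    HasMFDerivAt IG IP (fun a : G => u <• a) g (fundamentalVector IG IP (G := G) u) := by
  subst hg
  exact hasMFDerivAt_orbitMap hact u

theorem hasMFDerivAt_rightTranslation
    (hact : ContMDiff (IP.prod IG) IP ∞ (fun p : P × G => p.1 <• p.2)) (a : G) (u : P) :
    HasMFDerivAt IP IP (fun u : P => u <• a) u (mfderiv IP IP (fun u : P => u <• a) u) :=
  ((contMDiff_rightTranslation hact a).mdifferentiable (by simp) u).hasMFDerivAt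

/-- The projection is constant on orbits. -/
theorem mfderiv_fundamentalVector_eq_zero
    (hact : ContMDiff (IP.prod IG) IP ∞ (fun p : P × G => p.1 <• p.2))
    (hpr : ContMDiff IP IM ∞ pr) (hinv : ∀ (u : P) (a : G), pr (u <• a) = pr u) (u : P)
    (A : GroupLieAlgebra IG G) :
    mfderiv IP IM pr u (fundamentalVector IG IP u A) = 0 := by
  have h1 : HasMFDerivAt IP IM pr (u <• (1 : G)) (mfderiv IP IM pr u) := by
    rw [rightSmul_one]
    exact (hpr.mdifferentiable (by simp) u).hasMFDerivAt
  have h2 := h1.comp (1 : G) (hasMFDerivAt_orbitMap hact u)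
  have h3 : pr ∘ (fun a : G => u <• a) = fun _ => pr u := funext fun a => hinv u a
  rw [h3] at h2
  have h4 := hasMFDerivAt_unique h2 (hasMFDerivAt_const (pr u) (1 : G))
  exact DFunLike.congr_fun h4 A

/-- A right translation by `a` takes `A^*` to `(Ad_{a⁻¹} A)^*`. -/
theorem mfderiv_rightTranslation_fundamentalVector [LieGroup IG ∞ G]
    (hact : ContMDiff (IP.prod IG) IP ∞ (fun p : P × G => p.1 <• p.2)) (a : G) (u : P)
    (A : GroupLieAlgebra IG G) :
    mfderiv IP IP (fun v : P => v <• a) u (fundamentalVector IG IP u A) =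
      fundamentalVector IG IP (u <• a) (lieAd IG a⁻¹ A) := by
  have h1 : HasMFDerivAt IP IP (fun v : P => v <• a) (u <• (1 : G))
      (mfderiv IP IP (fun v : P => v <• a) u) := by
    rw [rightSmul_one]
    exact hasMFDerivAt_rightTranslation hact a u
  have h2 := h1.comp (1 : G) (hasMFDerivAt_orbitMap hact u)
  have hc : ContMDiff IG IG ∞ (fun x : G => a⁻¹ * x * a⁻¹⁻¹) :=
    (contMDiff_const.mul contMDiff_id).mul contMDiff_const
  have h3 : HasMFDerivAt IG IG (fun x : G => a⁻¹ * x * a⁻¹⁻¹) 1 (lieAd IG a⁻¹) :=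
    (hc.mdifferentiable (by simp) 1).hasMFDerivAt
  have h4 := (hasMFDerivAt_orbitMap_of_eq hact (u <• a)
    (g := a⁻¹ * 1 * a⁻¹⁻¹) (by simp)).comp (1 : G) h3
  -- This is u·x·a = (u·a)·(a⁻¹xa), to be differentiated at x = 1.
  have h5 : (fun v : P => v <• a) ∘ (fun x : G => u <• x) =
      (fun x : G => (u <• a) <• x) ∘ (fun x : G => a⁻¹ * x * a⁻¹⁻¹) := by
    funext x
    simp only [Function.comp_apply, ← rightSmul_mul]
    congr 2
    group
  rw [h5] at h2
  exact DFunLike.congr_fun (hasMFDerivAt_unique h2 h4) A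

variable {EG' HG' EP' HP' : Type*}
  [NormedAddCommGroup EG'] [NormedSpace ℝ EG'] [TopologicalSpace HG']
  [NormedAddCommGroup EP'] [NormedSpace ℝ EP'] [TopologicalSpace HP']
  {IG' : ModelWithCorners ℝ EG' HG'} {IP' : ModelWithCorners ℝ EP' HP'}
  {G' : Type*} [TopologicalSpace G'] [ChartedSpace HG' G'] [Group G']
  {P' : Type*} [TopologicalSpace P'] [ChartedSpace HP' P'] [MulAction G'ᵐᵒᵖ P']
  {pr' : P' → M} {f : G' →* G} {Φ : P' → P}

/-- Differentiate Φ(u·x) = Φ(u)·f(x) at x = 1. With `IsPrincipalHom.mfderiv_mfderiv` this makes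
(f_*, TΦ) a morphism of extensions over the tangent space of the base. -/
theorem IsPrincipalHom.mfderiv_fundamentalVector
    (hΦ : IsPrincipalHom IG' IP' IG IP pr' pr f Φ)
    (hact' : ContMDiff (IP'.prod IG') IP' ∞ (fun p : P' × G' => p.1 <• p.2))
    (hact : ContMDiff (IP.prod IG) IP ∞ (fun p : P × G => p.1 <• p.2)) (u : P')
    (A : GroupLieAlgebra IG' G') :
    mfderiv IP' IP Φ u (fundamentalVector IG' IP' u A) =
      fundamentalVector IG IP (Φ u) (lieMap IG' IG f A) := by
  have h1 : HasMFDerivAt IP' IP Φ (u <• (1 : G')) (mfderiv IP' IP Φ u) := by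
    rw [rightSmul_one]
    exact (hΦ.smooth.mdifferentiable (by simp) u).hasMFDerivAt
  have h2 := h1.comp (1 : G') (hasMFDerivAt_orbitMap hact' u)
  have h3 : HasMFDerivAt IG' IG f 1 (lieMap IG' IG f) :=
    (hΦ.smooth_group.mdifferentiable (by simp) 1).hasMFDerivAt
  have h4 := (hasMFDerivAt_orbitMap_of_eq hact (Φ u) (g := f 1) (by simp)).comp (1 : G') h3
  have h5 : Φ ∘ (fun x : G' => u <• x) = (fun x : G => Φ u <• x) ∘ f :=
    funext fun x => hΦ.equivariant u x
  rw [h5] at h2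
  exact DFunLike.congr_fun (hasMFDerivAt_unique h2 h4) A

/-- The equation is stated in the model space `EM` because the base points `pr (Φ u)` and `pr' u`
agree only propositionally. -/
theorem IsPrincipalHom.mfderiv_mfderiv (hΦ : IsPrincipalHom IG' IP' IG IP pr' pr f Φ)
    (hpr : ContMDiff IP IM ∞ pr) (u : P') (v : TangentSpace IP' u) :
    (mfderiv IP IM pr (Φ u) (mfderiv IP' IP Φ u v) : EM) = (mfderiv IP' IM pr' u v : EM) := by
  have h1 := ((hpr.mdifferentiable (by simp) (Φ u)).hasMFDerivAt).comp u
    (hΦ.smooth.mdifferentiable (by simp) u).hasMFDerivAt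
  have h2 : pr ∘ Φ = pr' := funext hΦ.proj_comp
  rw [h2] at h1
  rw [h1.mfderiv]
  rfl

theorem IsPrincipalHom.mfderiv_rightTranslation (hΦ : IsPrincipalHom IG' IP' IG IP pr' pr f Φ)
    (hact' : ContMDiff (IP'.prod IG') IP' ∞ (fun p : P' × G' => p.1 <• p.2))
    (hact : ContMDiff (IP.prod IG) IP ∞ (fun p : P × G => p.1 <• p.2)) (a : G') (u : P')
    (v : TangentSpace IP' u) :
    (mfderiv IP' IP Φ (u <• a) (mfderiv IP' IP' (fun w : P' => w <• a) u v) : EP) =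
      (mfderiv IP IP (fun w : P => w <• f a) (Φ u) (mfderiv IP' IP Φ u v) : EP) := by
  have h1 := (hΦ.smooth.mdifferentiable (by simp) (u <• a)).hasMFDerivAt.comp u
    (hasMFDerivAt_rightTranslation hact' a u)
  have h2 := (hasMFDerivAt_rightTranslation hact (f a) (Φ u)).comp u
    (hΦ.smooth.mdifferentiable (by simp) u).hasMFDerivAt
  have h3 : Φ ∘ (fun w : P' => w <• a) = (fun w : P => w <• f a) ∘ Φ :=
    funext fun w => hΦ.equivariant w a
  rw [h3] at h1
  exact DFunLike.congr_fun (hasMFDerivAt_unique h1 h2) v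

namespace IsPrincipalBundle

theorem proj_smul (hP : IsPrincipalBundle IM IG IP G pr) (u : P) (a : G) : pr (u <• a) = pr u :=
  ((hP.proj_eq_iff u (u <• a)).2 ⟨a, rfl⟩).symm

/-- Near each point `u`, a principal bundle has a local section `s` through `u` and a map `θ` to
the group that is the identity along the fibre, such that `v = s (pr v) <• θ v`. -/
theorem exists_section (hP : IsPrincipalBundle IM IG IP G pr) [LieGroup IG ∞ G] (u : P) :
    ∃ (s : M → P) (θ : P → G), ContMDiffAt IM IP ∞ s (pr u) ∧ ContMDiffAt IP IG ∞ θ u ∧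
      s (pr u) = u ∧ (∀ᶠ y in 𝓝 (pr u), pr (s y) = y) ∧ (∀ a : G, θ (u <• a) = a) ∧
      ∀ᶠ v in 𝓝 u, s (pr v) <• θ v = v := by
  obtain ⟨U, hU, hxU, Φ, hsrc, htgt, hsm, hsm', hΦ⟩ := hP.locally_trivial (pr u)
  have hu : u ∈ Φ.source := by rw [hsrc]; exact hxU
  have hmem : ∀ y ∈ U, ∀ g : G, (y, g) ∈ Φ.target := fun y hy g => by
    rw [htgt]; exact ⟨hy, mem_univ g⟩
  have hps : ∀ y ∈ U, ∀ g : G, pr (Φ.symm (y, g)) = y := fun y hy g => by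
    have h1 := (hΦ _ (Φ.map_target (hmem y hy g))).1
    rw [Φ.right_inv (hmem y hy g)] at h1
    exact h1.symm
  -- Multiplying the group coordinate on the left by the inverse of its value at `u` normalizes the
  -- trivialization, so that the section passes through `u` and `θ` inverts the orbit map.
  refine ⟨fun y => Φ.symm (y, (Φ u).2), fun v => (Φ u).2⁻¹ * (Φ v).2, ?_, ?_, ?_, ?_, ?_, ?_⟩
  · have h1 : ContMDiffAt (IM.prod IG) IP ∞ Φ.symm (pr u, (Φ u).2) :=
      hsm'.contMDiffAt (Φ.open_target.mem_nhds (hmem _ hxU _))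
    exact h1.comp (pr u) (contMDiffAt_id.prodMk contMDiffAt_const)
  · have h1 : ContMDiffAt IP (IM.prod IG) ∞ Φ u := hsm.contMDiffAt (Φ.open_source.mem_nhds hu)
    exact contMDiffAt_const.mul (contMDiffAt_snd.comp u h1)
  · have h1 : (pr u, (Φ u).2) = Φ u := Prod.ext (hΦ u hu).1.symm rfl
    simp only [h1, Φ.left_inv hu]
  · filter_upwards [hU.mem_nhds hxU] with y hy using hps y hy _
  · intro a
    change (Φ u).2⁻¹ * (Φ (u <• a)).2 = a
    rw [(hΦ u hu).2 a, inv_mul_cancel_left]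
  · filter_upwards [Φ.open_source.mem_nhds hu] with v hv
    have hvU : pr v ∈ U := by rw [hsrc] at hv; exact hv
    have hs : Φ.symm (pr v, (Φ u).2) ∈ Φ.source := Φ.map_target (hmem _ hvU _)
    have hs2 : Φ.symm (pr v, (Φ u).2) <• ((Φ u).2⁻¹ * (Φ v).2) ∈ Φ.source := by
      rw [hsrc, mem_preimage, hP.proj_smul, hps _ hvU]
      exact hvU
    refine Φ.injOn hs2 hv (Prod.ext ?_ ?_)
    · rw [(hΦ _ hs2).1, (hΦ _ hv).1, hP.proj_smul, hps _ hvU]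
    · rw [(hΦ _ hs).2, Φ.right_inv (hmem _ hvU _), mul_inv_cancel_left]

/-- The derivative of a local section is a right inverse. -/
theorem mfderiv_proj_surjective (hP : IsPrincipalBundle IM IG IP G pr) [LieGroup IG ∞ G] (u : P) :
    Function.Surjective (mfderiv IP IM pr u) := by
  obtain ⟨s, θ, hs, -, hsu, hps, -, -⟩ := hP.exists_section u
  have h1 : HasMFDerivAt IP IM pr (s (pr u)) (mfderiv IP IM pr u) := by
    rw [hsu]
    exact (hP.smooth_proj.mdifferentiable (by simp) u).hasMFDerivAt
  have h2 := h1.comp (pr u) (hs.mdifferentiableAt (by simp)).hasMFDerivAt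
  have h3 := h2.congr_of_eventuallyEq (f₁ := id) (by
    filter_upwards [hps] with y hy using hy.symm)
  have h4 := hasMFDerivAt_unique h3 (hasMFDerivAt_id (pr u))
  intro x
  exact ⟨_, DFunLike.congr_fun h4 x⟩

/-- The map `θ` is a left inverse of the orbit map of `u`. -/
theorem fundamentalVector_injective (hP : IsPrincipalBundle IM IG IP G pr) [LieGroup IG ∞ G]
    (u : P) : Function.Injective (fundamentalVector IG IP (G := G) u) := by
  obtain ⟨s, θ, -, hθ, -, -, hθa, -⟩ := hP.exists_section u
  have h1 : HasMFDerivAt IP IG θ (u <• (1 : G)) (mfderiv IP IG θ u) := by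
    rw [rightSmul_one]
    exact (hθ.mdifferentiableAt (by simp)).hasMFDerivAt
  have h2 := h1.comp (1 : G) (hasMFDerivAt_orbitMap hP.smooth_action u)
  rw [show θ ∘ (fun a : G => u <• a) = id from funext hθa] at h2
  have h4 := hasMFDerivAt_unique h2 (hasMFDerivAt_id (1 : G))
  intro A B hAB
  have hA := DFunLike.congr_fun h4 A
  have hB := DFunLike.congr_fun h4 B
  have : ((mfderiv IP IG θ u) ∘L (fundamentalVector IG IP (G := G) u) : EG →L[ℝ] EG) A =
      ((mfderiv IP IG θ u) ∘L (fundamentalVector IG IP (G := G) u) : EG →L[ℝ] EG) B :=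
    congrArg (mfderiv IP IG θ u) hAB
  exact hA.symm.trans (this.trans hB)

/-- Exactness in the middle: differentiate w = s(pr w)·θ(w) at u along v. As v is vertical, only the
θ-term survives, and it is the fundamental vector of Tθ(v). -/
theorem exists_fundamentalVector_eq (hP : IsPrincipalBundle IM IG IP G pr) [LieGroup IG ∞ G]
    {u : P} {v : TangentSpace IP u} (hv : mfderiv IP IM pr u v = 0) :
    ∃ A : GroupLieAlgebra IG G, fundamentalVector IG IP u A = v := by
  obtain ⟨s, θ, hs, hθ, hsu, -, hθa, hsθ⟩ := hP.exists_section u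
  have hθu : θ u = 1 := by have := hθa 1; rwa [rightSmul_one] at this
  refine ⟨mfderiv IP IG θ u v, ?_⟩
  have h1 := (hs.mdifferentiableAt (by simp)).hasMFDerivAt.comp u
    (hP.smooth_proj.mdifferentiable (by simp) u).hasMFDerivAt
  have h2 := h1.prodMk (hθ.mdifferentiableAt (by simp)).hasMFDerivAt
  set D := mfderiv (IP.prod IG) IP (fun p : P × G => p.1 <• p.2) (u, 1) with hD
  have h3 : HasMFDerivAt (IP.prod IG) IP (fun p : P × G => p.1 <• p.2) ((s ∘ pr) u, θ u) D := by
    have h : ((s ∘ pr) u, θ u) = (u, 1) := Prod.ext hsu hθu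
    rw [h]
    exact (hP.smooth_action.mdifferentiable (by simp) (u, 1)).hasMFDerivAt
  have h4 := (h3.comp u h2).congr_of_eventuallyEq (f₁ := id) (by
    filter_upwards [hsθ] with w hw using hw.symm)
  have h5 := DFunLike.congr_fun (hasMFDerivAt_unique h4 (hasMFDerivAt_id u)) v
  have h6 := (hP.smooth_action.mdifferentiable (by simp) (u, 1)).hasMFDerivAt.comp (1 : G)
    ((hasMFDerivAt_const u (1 : G)).prodMk (hasMFDerivAt_id (1 : G)))
  have h7 := hasMFDerivAt_unique h6 (hasMFDerivAt_orbitMap hP.smooth_action u)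
  have h8 := DFunLike.congr_fun h7 (mfderiv IP IG θ u v)
  refine h8.symm.trans (Eq.trans ?_ h5)
  have h9 : (mfderiv IM IP s (pr u) (mfderiv IP IM pr u v) : EP) = 0 := by
    rw [hv]; exact map_zero _
  change D ((0 : EP), (mfderiv IP IG θ u v : EG)) =
    D ((mfderiv IM IP s (pr u) (mfderiv IP IM pr u v) : EP), (mfderiv IP IG θ u v : EG))
  exact congrArg (fun z : EP => D (z, (mfderiv IP IG θ u v : EG))) h9.symm

end IsPrincipalBundle

end PrincipalBundle

/-! ### Homomorphisms of Lie groups with discrete kernel -/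

section LieGroupHom

variable {EG HG EG' HG' : Type*}
  [NormedAddCommGroup EG] [NormedSpace ℝ EG] [TopologicalSpace HG]
  [NormedAddCommGroup EG'] [NormedSpace ℝ EG'] [TopologicalSpace HG']
  {IG : ModelWithCorners ℝ EG HG} {IG' : ModelWithCorners ℝ EG' HG'}
  {G : Type*} [TopologicalSpace G] [ChartedSpace HG G] [Group G]
  {G' : Type*} [TopologicalSpace G'] [ChartedSpace HG' G'] [Group G'] {f : G' →* G}

/-- A curve with vanishing velocity is locally constant. -/
theorem eventually_eq_of_hasMFDerivAt_zero {E H M : Type*} [NormedAddCommGroup E] [NormedSpace ℝ E]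
    [TopologicalSpace H] {I : ModelWithCorners ℝ E H} [TopologicalSpace M] [ChartedSpace H M]
    [IsManifold I 1 M] {γ : ℝ → M} {t₀ : ℝ}
    (h : ∀ᶠ t in 𝓝 t₀, HasMFDerivAt 𝓘(ℝ, ℝ) I γ t 0) : ∀ᶠ t in 𝓝 t₀, γ t = γ t₀ := by
  have hc : ContinuousAt γ t₀ := h.self_of_nhds.continuousAt
  have hsrc : ∀ᶠ t in 𝓝 t₀, γ t ∈ (chartAt H (γ t₀)).source :=
    hc.eventually_mem (chart_source_mem_nhds H (γ t₀))
  obtain ⟨ε, hε, hball⟩ := Metric.eventually_nhds_iff_ball.1 (h.and hsrc)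
  have hd : ∀ t ∈ Metric.ball t₀ ε, HasFDerivAt (fun t => extChartAt I (γ t₀) (γ t))
      (0 : ℝ →L[ℝ] E) t := fun t ht => by
    have h1 : MDifferentiableAt I 𝓘(ℝ, E) (extChartAt I (γ t₀)) (γ t) :=
      (contMDiffAt_extChartAt' (n := 1) (hball t ht).2).mdifferentiableAt one_ne_zero
    have h2 := h1.hasMFDerivAt.comp t (hball t ht).1
    rw [ContinuousLinearMap.comp_zero] at h2
    exact h2.hasFDerivAt
  filter_upwards [Metric.ball_mem_nhds t₀ hε] with t ht
  have heq := (convex_ball t₀ ε).is_const_of_fderivWithin_eq_zero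
    (f := fun t => extChartAt I (γ t₀) (γ t)) (𝕜 := ℝ)
    (fun s hs => (hd s hs).differentiableAt.differentiableWithinAt)
    (fun s hs => by
      rw [fderivWithin_of_isOpen Metric.isOpen_ball hs, (hd s hs).fderiv])
    ht (Metric.mem_ball_self hε)
  refine (extChartAt I (γ t₀)).injOn ?_ (mem_extChartAt_source _) heq
  rw [extChartAt_source]
  exact (hball t ht).2

/-- The derivative at the identity of a homomorphism of Lie groups with discrete kernel is
injective. -/
theorem lieMap_injective [LieGroup IG ∞ G] [LieGroup IG' ∞ G'] [CompleteSpace EG']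
    [IG'.Boundaryless] (hf : ContMDiff IG' IG ∞ f) [DiscreteTopology f.ker] :
    Function.Injective (lieMap IG' IG f) := by
  have : LieGroup IG' (minSmoothness ℝ 3) G' := LieGroup.of_le (n := ∞) (by
    rw [minSmoothness_of_isRCLikeNormedField]; exact WithTop.coe_le_coe.2 le_top)
  have : LieGroup IG 1 G := LieGroup.of_le (n := ∞) (by simp)
  have : IsManifold IG' 1 G' := IsManifold.of_le (n := ∞) (by simp)
  rw [injective_iff_map_eq_zero]
  intro B hB
  -- An integral curve through 1 of the left-invariant field of `B` replaces the one-parameter group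
  -- exp(tB).
  obtain ⟨γ, hγ0, hγ⟩ := exists_isMIntegralCurveAt_of_contMDiffAt_boundaryless
    (I := IG') (t₀ := 0) (v := mulInvariantVectorField B) (x₀ := (1 : G'))
    ((contMDiff_mulInvariantVectorField B).contMDiffAt.of_le (by simp))
  -- Since f intertwines left translations, its derivative kills the left-invariant field of `B`
  -- everywhere once it does so at 1.
  have hzero : ∀ g : G', (mfderiv IG' IG f g (mulInvariantVectorField B g) : EG) = 0 := by
    intro g
    have h1 : HasMFDerivAt IG' IG f (g * 1) (mfderiv IG' IG f g) := by
      rw [mul_one]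
      exact (hf.mdifferentiable (by simp) g).hasMFDerivAt
    have h2 := h1.comp (1 : G')
      ((contMDiff_mul_left (I := IG') (n := ∞) (a := g)).mdifferentiable
        (by simp) 1).hasMFDerivAt
    have h3 : HasMFDerivAt IG' IG f 1 (lieMap IG' IG f) :=
      (hf.mdifferentiable (by simp) 1).hasMFDerivAt
    have h4 := ((contMDiff_mul_left (I := IG) (n := ∞) (a := f g)).mdifferentiable
      (by simp) (f 1)).hasMFDerivAt.comp (1 : G') h3
    rw [show f ∘ (fun x => g * x) = (fun x => f g * x) ∘ f from funext fun x => map_mul f g x] at h2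
    refine (DFunLike.congr_fun (hasMFDerivAt_unique h2 h4) B).trans ?_
    have h5 : (mfderiv IG IG (fun x => f g * x) (f 1) : EG →L[ℝ] EG) (lieMap IG' IG f B : EG) =
        0 := by
      rw [hB]; exact map_zero _
    exact h5
  have hconst : ∀ᶠ t in 𝓝 (0 : ℝ), (f ∘ γ) t = (f ∘ γ) 0 := by
    refine eventually_eq_of_hasMFDerivAt_zero (I := IG) ?_
    filter_upwards [hγ] with t ht
    have h1 := (hf.mdifferentiable (by simp) (γ t)).hasMFDerivAt.comp t ht
    convert! h1 using 1
    refine ContinuousLinearMap.ext_ring ?_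
    have h2 := hzero (γ t)
    change (0 : EG) = (mfderiv IG' IG f (γ t) : EG' →L[ℝ] EG)
      ((1 : ℝ) • mulInvariantVectorField B (γ t) : EG')
    rw [one_smul]
    exact h2.symm
  have hγc : ContinuousAt γ 0 := hγ.self_of_nhds.continuousAt
  -- The curve lies in the kernel for small times, and 1 is isolated there. So the curve is constant
  -- near 0, and its velocity `B` vanishes.
  obtain ⟨U, hU, hU1⟩ : ∃ U ∈ 𝓝 (1 : G'), ∀ x ∈ U, f x = 1 → x = 1 := by
    have h1 : ({1} : Set f.ker) ∈ 𝓝 (1 : f.ker) := (isOpen_discrete _).mem_nhds rfl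
    obtain ⟨U, hU, hU'⟩ := mem_nhds_subtype (f.ker : Set G') (1 : f.ker) {1} |>.1 h1
    refine ⟨U, hU, fun x hx hfx => ?_⟩
    have : (⟨x, hfx⟩ : f.ker) ∈ ({1} : Set f.ker) := hU' hx
    exact congrArg Subtype.val this
  have hγ1 : γ =ᶠ[𝓝 0] fun _ => (1 : G') := by
    filter_upwards [hconst, hγc.eventually_mem (by rw [hγ0]; exact hU)] with t ht htU
    refine hU1 _ htU ?_
    simpa [hγ0] using ht
  have h1 := (hasMFDerivAt_const (I := 𝓘(ℝ, ℝ)) (I' := IG') (1 : G') (0 : ℝ)).congr_of_eventuallyEq hγ1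
  have h2 := DFunLike.congr_fun (hasMFDerivAt_unique h1 hγ.self_of_nhds) (1 : ℝ)
  have h3 : (0 : EG') = (1 : ℝ) • (mulInvariantVectorField (I := IG') B (γ 0) : EG') := h2
  rw [one_smul, hγ0] at h3
  have h4 : (mulInvariantVectorField (I := IG') B (1 : G') : EG') = B := by
    have : (fun x : G' => 1 * x) = id := funext fun x => one_mul x
    unfold mulInvariantVectorField
    rw [this, mfderiv_id]
    rfl
  exact h4.symm.trans h3.symm

/-- A smooth surjection of a second countable manifold onto a manifold does not raise the
dimension. -/
theorem finrank_le_of_surjective {E H M E' H' M' : Type*} [NormedAddCommGroup E] [NormedSpace ℝ E]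
    [FiniteDimensional ℝ E] [TopologicalSpace H] {I : ModelWithCorners ℝ E H} [I.Boundaryless]
    [TopologicalSpace M] [ChartedSpace H M] [IsManifold I 1 M]
    [NormedAddCommGroup E'] [NormedSpace ℝ E'] [FiniteDimensional ℝ E'] [TopologicalSpace H']
    {I' : ModelWithCorners ℝ E' H'} [I'.Boundaryless] [TopologicalSpace M'] [ChartedSpace H' M']
    [IsManifold I' 1 M'] [SecondCountableTopology M'] [Nonempty M] {g : M' → M}
    (hg : ContMDiff I' I 1 g) (hs : Function.Surjective g) :
    Module.finrank ℝ E ≤ Module.finrank ℝ E' := by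
  obtain ⟨y₀⟩ := ‹Nonempty M›
  set κ := extChartAt I y₀ with hκ
  -- Hausdorff dimension takes the place of Sard's theorem: in charts `g` is locally Lipschitz, so
  -- small pieces have images of dimension at most dim E'. Countably many of these images cover a
  -- chart target, which has dimension dim E.
  have hloc : ∀ x : M', ∃ U ∈ 𝓝 x, g x ∈ κ.source → dimH (κ '' (g '' U)) ≤ Module.finrank ℝ E' := by
    intro x
    by_cases hx : g x ∈ κ.source
    · have h1 : ContMDiffAt I 𝓘(ℝ, E) 1 κ (g x) := contMDiffAt_extChartAt' (by
        rwa [hκ, extChartAt_source] at hx)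
      have h2 : ContMDiffAt I' 𝓘(ℝ, E) 1 (κ ∘ g) x := h1.comp x hg.contMDiffAt
      have h3 : ContDiffAt ℝ 1 (κ ∘ g ∘ (extChartAt I' x).symm) (extChartAt I' x x) := by
        have := contMDiffAt_iff_source.1 h2
        rw [I'.range_eq_univ, contMDiffWithinAt_univ] at this
        exact this.contDiffAt
      obtain ⟨C, s, hs, hC⟩ := h3.exists_lipschitzOnWith
      refine ⟨(extChartAt I' x).source ∩ extChartAt I' x ⁻¹' s, Filter.inter_mem
        (extChartAt_source_mem_nhds x) ((continuousAt_extChartAt x).preimage_mem_nhds hs),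
        fun _ => ?_⟩
      refine (dimH_mono ?_).trans (hC.dimH_image_le.trans
        ((dimH_mono (subset_univ s)).trans (Real.dimH_univ_eq_finrank E').le))
      rintro _ ⟨_, ⟨z, ⟨hz, hzs⟩, rfl⟩, rfl⟩
      exact ⟨extChartAt I' x z, hzs, by
        rw [Function.comp_apply, Function.comp_apply, (extChartAt I' x).left_inv hz]⟩
    · exact ⟨univ, Filter.univ_mem, fun h => absurd h hx⟩
  choose U hU hdim using hloc
  obtain ⟨t, ht, htc, htU⟩ := TopologicalSpace.countable_cover_nhdsWithin (s := g ⁻¹' κ.source)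
    (f := U) (fun x _ => mem_nhdsWithin_of_mem_nhds (hU x))
  have hsub : κ.target ⊆ ⋃ x ∈ t, κ '' (g '' U x) := by
    intro y hy
    obtain ⟨z, hz⟩ := hs (κ.symm y)
    have hzs : z ∈ g ⁻¹' κ.source := by rw [mem_preimage, hz]; exact κ.map_target hy
    obtain ⟨x, hx, hzx⟩ := mem_iUnion₂.1 (htU hzs)
    exact mem_iUnion₂.2 ⟨x, hx, _, ⟨z, hzx, hz⟩, κ.right_inv hy⟩
  have h1 : dimH κ.target = Module.finrank ℝ E :=
    Real.dimH_of_mem_nhds (extChartAt_target_mem_nhds (I := I) y₀)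
  have h2 : dimH κ.target ≤ Module.finrank ℝ E' := by
    refine (dimH_mono hsub).trans ?_
    rw [dimH_bUnion htc]
    exact iSup₂_le fun x hx => hdim x (ht hx)
  rw [h1] at h2
  exact_mod_cast h2

/-- The derivative at the identity of a surjective homomorphism of Lie groups with discrete kernel
is bijective. -/
theorem lieMap_bijective [LieGroup IG ∞ G] [LieGroup IG' ∞ G'] [FiniteDimensional ℝ EG]
    [FiniteDimensional ℝ EG'] [IG.Boundaryless] [IG'.Boundaryless] [SecondCountableTopology G']
    (hf : ContMDiff IG' IG ∞ f) (hs : Function.Surjective f) [DiscreteTopology f.ker] :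
    Function.Bijective (lieMap IG' IG f) := by
  have : CompleteSpace EG' := FiniteDimensional.complete ℝ EG'
  have : IsManifold IG' 1 G' := IsManifold.of_le (n := ∞) (by simp)
  have : IsManifold IG 1 G := IsManifold.of_le (n := ∞) (by simp)
  have hinj := lieMap_injective (IG := IG) (IG' := IG') hf
  have h1 := finrank_le_of_surjective (hf.of_le (m := 1) (by simp)) hs
  let F : EG' →L[ℝ] EG := lieMap IG' IG f
  have hinj' : Function.Injective F.toLinearMap := hinj
  have h2 := LinearMap.finrank_le_finrank_of_injective hinj'
  exact ⟨hinj, (LinearMap.injective_iff_surjective_of_finrank_eq_finrank (le_antisymm h2 h1)).1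
    hinj'⟩

end LieGroupHom

/-! ### Flows of vector fields in a chart -/

section ChartFlow

variable {E H : Type*} [NormedAddCommGroup E] [NormedSpace ℝ E] [TopologicalSpace H]
  {I : ModelWithCorners ℝ E H} {M : Type*} [TopologicalSpace M] [ChartedSpace H M]
  {X : (x : M) → TangentSpace I x}

/-- The expression of a vector field in the chart at `x₀`. -/
def chartField (X : (x : M) → TangentSpace I x) (x₀ : M) : E → E := fun y =>
  mfderiv I 𝓘(ℝ, E) (extChartAt I x₀) ((extChartAt I x₀).symm y) (X ((extChartAt I x₀).symm y))

theorem chartField_extChartAt (X : (x : M) → TangentSpace I x) {x₀ x : M}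
    (hx : x ∈ (chartAt H x₀).source) :
    chartField X x₀ (extChartAt I x₀ x) = mfderiv I 𝓘(ℝ, E) (extChartAt I x₀) x (X x) := by
  unfold chartField
  rw [(extChartAt I x₀).left_inv (by rwa [extChartAt_source])]

/-- Relates smoothness of a section of the tangent bundle, tested in a trivialization, to smoothness
of `chartField`. -/
theorem trivializationAt_tangent_snd [IsManifold I 1 M] {x₀ x : M}
    (hx : x ∈ (chartAt H x₀).source) (v : TangentSpace I x) :
    (trivializationAt E (TangentSpace I) x₀ ⟨x, v⟩).2 =
      mfderiv I 𝓘(ℝ, E) (extChartAt I x₀) x v := by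
  refine Eq.trans ?_
    (DFunLike.congr_fun (TangentBundle.continuousLinearMapAt_trivializationAt (I := I) hx) v)
  rw [Trivialization.continuousLinearMapAt_apply, Trivialization.coe_linearMapAt_of_mem _ hx]

theorem contDiffOn_chartField [IsManifold I ∞ M] [I.Boundaryless] (hX : IsSmoothVectorField I X)
    (x₀ : M) : ContDiffOn ℝ ∞ (chartField X x₀) (extChartAt I x₀).target := by
  have : IsManifold I 1 M := IsManifold.of_le (n := ∞) (by simp)
  have : IsManifold I (∞ + 1) M := by simpa
  rw [← contMDiffOn_iff_contDiffOn]
  have hsrc : ∀ y ∈ (extChartAt I x₀).target,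
      (extChartAt I x₀).symm y ∈ (chartAt H x₀).source := fun y hy => by
    rw [← extChartAt_source (I := I)]
    exact (extChartAt I x₀).map_target hy
  intro y hy
  have h1 := ((trivializationAt E (TangentSpace I) x₀).contMDiffAt_section_iff (IB := I) (n := ∞)
    (s := X) (x₀ := (extChartAt I x₀).symm y) (hsrc y hy)).1 (hX _)
  exact (h1.comp_contMDiffWithinAt y (contMDiffOn_extChartAt_symm (n := ∞) x₀ y hy)).congr
    (fun z hz => (trivializationAt_tangent_snd (hsrc z hz) _).symm)
    (trivializationAt_tangent_snd (hsrc y hy) _).symm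

theorem hasMFDerivAt_extChartAt_symm [IsManifold I 1 M] [I.Boundaryless] {x₀ : M} {y : E}
    (hy : y ∈ (extChartAt I x₀).target) :
    HasMFDerivAt 𝓘(ℝ, E) I (extChartAt I x₀).symm y
      (mfderiv 𝓘(ℝ, E) I (extChartAt I x₀).symm y) := by
  have := mdifferentiableWithinAt_extChartAt_symm hy
  rw [I.range_eq_univ, mdifferentiableWithinAt_univ] at this
  exact this.hasMFDerivAt

theorem mfderiv_extChartAt_symm_chartField [IsManifold I 1 M] [I.Boundaryless] {x₀ : M} {y : E}
    (hy : y ∈ (extChartAt I x₀).target) :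
    mfderiv 𝓘(ℝ, E) I (extChartAt I x₀).symm y (chartField X x₀ y : E) =
      X ((extChartAt I x₀).symm y) := by
  have := mfderivWithin_extChartAt_symm_comp_mfderiv_extChartAt hy
  rw [I.range_eq_univ, mfderivWithin_univ] at this
  exact DFunLike.congr_fun this (X ((extChartAt I x₀).symm y))

/-- The given curve rules out the dummy value, and uniqueness of integral curves on a Hausdorff
manifold identifies it with the curve chosen in `vectorFlow` on the common interval. -/
theorem vectorFlow_eq_of_isMIntegralCurveOn [IsManifold I ∞ M] [I.Boundaryless] [T2Space M]
    (hX : IsSmoothVectorField I X) {γ : ℝ → M} {ε t : ℝ}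
    (hγ : IsMIntegralCurveOn γ X (Ioo (-ε) ε)) (ht : t ∈ Ioo (-ε) ε) :
    vectorFlow I X t (γ 0) = γ t := by
  have : IsManifold I 1 M := IsManifold.of_le (n := ∞) (by simp)
  have hε : 0 < ε := by linarith [ht.1, ht.2]
  have hex : ∃ γ' : ℝ → M, γ' 0 = γ 0 ∧ ∃ a b : ℝ, 0 ∈ Ioo a b ∧ t ∈ Ioo a b ∧
      IsMIntegralCurveOn (I := I) γ' X (Ioo a b) :=
    ⟨γ, rfl, -ε, ε, ⟨by linarith, hε⟩, ht, hγ⟩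
  rw [vectorFlow, dif_pos hex]
  obtain ⟨h0, a, b, h0ab, htab, hc⟩ := hex.choose_spec
  have hsub : ∀ (a' b' : ℝ), Ioo (max a (-ε)) (min b ε) ⊆ Ioo a b := fun _ _ =>
    Ioo_subset_Ioo (le_max_left _ _) (min_le_left _ _)
  refine isMIntegralCurveOn_Ioo_eqOn_of_contMDiff_boundaryless (I := I) (t₀ := 0)
    (a := max a (-ε)) (b := min b ε) (v := X)
    ⟨max_lt h0ab.1 (by linarith), lt_min h0ab.2 hε⟩ (hX.of_le (by simp))
    (hc.mono (Ioo_subset_Ioo (le_max_left _ _) (min_le_left _ _)))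
    (hγ.mono (Ioo_subset_Ioo (le_max_right _ _) (min_le_right _ _))) h0
    ⟨max_lt htab.1 ht.1, lt_min htab.2 ht.2⟩

/-- The flow of a vector field and its derivative, in a chart. -/
theorem exists_vectorFlow_chart [IsManifold I ∞ M] [I.Boundaryless] [T2Space M] [CompleteSpace E]
    (hX : IsSmoothVectorField I X) {x₀ x : M} (hx : x ∈ (chartAt H x₀).source) :
    ∃ (γ : ℝ → E) (A : ℝ → E →L[ℝ] E),
      γ 0 = extChartAt I x₀ x ∧ HasDerivAt γ (chartField X x₀ (extChartAt I x₀ x)) 0 ∧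
      A 0 = ContinuousLinearMap.id ℝ E ∧
      HasDerivAt A (fderiv ℝ (chartField X x₀) (extChartAt I x₀ x)) 0 ∧
      ∀ᶠ t in 𝓝 (0 : ℝ), γ t ∈ (extChartAt I x₀).target ∧
        vectorFlow I X t x = (extChartAt I x₀).symm (γ t) ∧
        mfderiv I 𝓘(ℝ, E) (extChartAt I x₀) (vectorFlow I X t x) ∘L
          mfderiv I I (vectorFlow I X t) x = A t ∘L mfderiv I 𝓘(ℝ, E) (extChartAt I x₀) x := by
  have : IsManifold I 1 M := IsManifold.of_le (n := ∞) (by simp)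
  set c := extChartAt I x₀ with hc
  have hxs : x ∈ c.source := by rwa [hc, extChartAt_source]
  have hopen : IsOpen c.target := isOpen_extChartAt_target x₀
  obtain ⟨δ, hδ, ε, hε, α, A, hα, hA, hA0, hA'⟩ := exists_local_flow_hasFDerivAt hopen
    ((contDiffOn_chartField hX x₀).of_le (WithTop.coe_le_coe.2 le_top)) (c.map_source hxs)
  have h0 : (0 : ℝ) ∈ Ioo (-ε) ε := ⟨by linarith, hε⟩
  have hcx := hα (c x) (Metric.mem_ball_self hδ)
  -- A whole neighbourhood with a common time interval is needed, since the flow map is to be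
  -- differentiated in the initial point.
  have hflow : ∀ y ∈ Metric.ball (c x) δ, ∀ t ∈ Ioo (-ε) ε,
      vectorFlow I X t (c.symm y) = c.symm (α y t) := by
    intro y hy t ht
    have hint : IsMIntegralCurveOn (fun t => c.symm (α y t)) X (Ioo (-ε) ε) := by
      intro s hs
      have h1 := (hasMFDerivAt_extChartAt_symm ((hα y hy).2 s hs).1).comp s
        (((hα y hy).2 s hs).2.hasFDerivAt.hasMFDerivAt)
      refine HasMFDerivAt.hasMFDerivWithinAt (h1.congr_mfderiv ?_)
      refine ContinuousLinearMap.ext_ring ?_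
      have h2 := mfderiv_extChartAt_symm_chartField (X := X) ((hα y hy).2 s hs).1
      change mfderiv 𝓘(ℝ, E) I (extChartAt I x₀).symm (α y s)
        ((1 : ℝ) • chartField X x₀ (α y s) : E) = ((1 : ℝ) • X (c.symm (α y s)) : E)
      rw [one_smul, one_smul]
      exact h2
    have := vectorFlow_eq_of_isMIntegralCurveOn hX hint ht
    simpa only [(hα y hy).1] using this
  refine ⟨α (c x), A, hcx.1, ?_, hA0, hA', ?_⟩
  · have := (hcx.2 0 h0).2
    rwa [hcx.1] at this
  filter_upwards [Ioo_mem_nhds h0.1 h0.2] with t ht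
  have htx : vectorFlow I X t x = c.symm (α (c x) t) := by
    rw [← hflow (c x) (Metric.mem_ball_self hδ) t ht, c.left_inv hxs]
  refine ⟨(hcx.2 t ht).1, htx, ?_⟩
  have hnear : ∀ᶠ z in 𝓝 x, z ∈ c.source ∧ c z ∈ Metric.ball (c x) δ :=
    Filter.Eventually.and ((isOpen_extChartAt_source x₀).mem_nhds hxs)
      ((continuousAt_extChartAt' hxs).eventually_mem (Metric.ball_mem_nhds _ hδ))
  have hcd : HasMFDerivAt I 𝓘(ℝ, E) c x (mfderiv I 𝓘(ℝ, E) c x) :=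
    (mdifferentiableAt_extChartAt hx).hasMFDerivAt
  have h1 := ((hA t ht).hasMFDerivAt).comp x hcd
  have h2 := ((hasMFDerivAt_extChartAt_symm (hcx.2 t ht).1).comp x h1).congr_of_eventuallyEq
    (f₁ := vectorFlow I X t) (by
      filter_upwards [hnear] with z hz
      change vectorFlow I X t z = c.symm (α (c z) t)
      rw [← hflow (c z) hz.2 t ht, c.left_inv hz.1])
  have hys : vectorFlow I X t x ∈ (chartAt H x₀).source := by
    rw [htx, ← extChartAt_source (I := I)]
    exact c.map_target (hcx.2 t ht).1
  -- The chart composed with the flow is differentiated in two ways: by the chain rule, and as the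
  -- local flow composed with the chart.
  have h3 := (mdifferentiableAt_extChartAt (I := I) hys).hasMFDerivAt.comp x
    h2.mdifferentiableAt.hasMFDerivAt
  have h4 := h1.congr_of_eventuallyEq (f₁ := c ∘ vectorFlow I X t) (by
      filter_upwards [hnear] with z hz
      change c (vectorFlow I X t z) = α (c z) t
      rw [← c.right_inv ((hα (c z) hz.2).2 t ht).1, ← hflow (c z) hz.2 t ht, c.left_inv hz.1])
  exact hasMFDerivAt_unique h3 h4

end ChartFlow

/-! ### The frame bundle in coordinates -/

section FrameBundle

variable {m : ℕ} {M : Type*} [TopologicalSpace M] [ChartedSpace (RSpace m) M]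
  [IsManifold (𝓡 m) ∞ M]

-- This and the next definitions are shortcuts for instance search, made local instances below; they
-- carry no new structure.
@[reducible] def frameSMul : SMul (GLGroup m)ᵐᵒᵖ (FrameBundle m M) := frameAction.toSMul

@[reducible] def frameTopologicalSpace : TopologicalSpace (FrameBundle m M) := inferInstance

@[reducible] def glTopologicalSpace : TopologicalSpace (GLGroup m) := inferInstance

@[reducible] def frameChartedSpace :
    ChartedSpace (ModelProd (RSpace m) (RSpace m →L[ℝ] RSpace m)) (FrameBundle m M) :=
  inferInstance

@[reducible] def glChartedSpace : ChartedSpace (RSpace m →L[ℝ] RSpace m) (GLGroup m) :=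
  inferInstance

@[reducible] def frameGLChartedSpace : ChartedSpace (ModelProd (ModelProd (RSpace m)
    (RSpace m →L[ℝ] RSpace m)) (RSpace m →L[ℝ] RSpace m)) (FrameBundle m M × GLGroup m) :=
  inferInstance

theorem isManifold_frameBundle_one : IsManifold (frameModel m) 1 (FrameBundle m M) :=
  IsManifold.of_le (n := ∞) (by simp)

attribute [local instance] frameSMul frameTopologicalSpace glTopologicalSpace frameChartedSpace
  glChartedSpace frameGLChartedSpace isManifold_frameBundle_one

/-- The coordinates of a frame induced by the chart of the base at `x₀`. -/
def frameCoord (x₀ : M) (u : FrameBundle m M) : RSpace m × (RSpace m →L[ℝ] RSpace m) :=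
  (extChartAt (𝓡 m) x₀ (frameProj u),
    mfderiv (𝓡 m) 𝓘(ℝ, RSpace m) (extChartAt (𝓡 m) x₀) (frameProj u) ∘L frameMap u)

theorem frameProj_smul (u : FrameBundle m M) (a : GLGroup m) :
    frameProj (u <• a) = frameProj u := rfl

theorem frameCoord_smul (x₀ : M) (u : FrameBundle m M) (a : GLGroup m) :
    frameCoord x₀ (u <• a) =
      ((frameCoord x₀ u).1, (frameCoord x₀ u).2 ∘L (a : RSpace m →L[ℝ] RSpace m)) := rfl

theorem extChartAt_frameBundle_source (u₀ : FrameBundle m M) :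
    (extChartAt (frameModel m) u₀).source =
      frameProj ⁻¹' (chartAt (RSpace m) (frameProj u₀)).source := by
  rw [extChartAt_source, TopologicalSpace.Opens.chartAt_eq,
    OpenPartialHomeomorph.subtypeRestr_source, FiberBundle.chartedSpace_chartAt]
  ext u
  simp only [OpenPartialHomeomorph.trans_source, mem_preimage, mem_inter_iff]
  rw [hom_trivializationAt_source]
  simp only [Trivial.fiberBundle_trivializationAt', Trivial.trivialization_baseSet,
    TangentBundle.trivializationAt_baseSet, univ_inter, mem_preimage,
    OpenPartialHomeomorph.prod_source, OpenPartialHomeomorph.refl_source, mem_prod, mem_univ,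
    and_true, Trivialization.coe_coe]
  exact and_iff_left_of_imp fun h => h

theorem mem_extChartAt_frameBundle_source {u₀ u : FrameBundle m M} :
    u ∈ (extChartAt (frameModel m) u₀).source ↔
      frameProj u ∈ (chartAt (RSpace m) (frameProj u₀)).source := by
  rw [extChartAt_frameBundle_source]
  rfl

/-- The trivialization of the Hom bundle composes a frame with the derivative of the base chart, the
trivial factor contributing the identity. All computations on the frame bundle use these coordinates
(x, p). -/
theorem extChartAt_frameBundle_apply {u₀ u : FrameBundle m M}
    (hu : frameProj u ∈ (chartAt (RSpace m) (frameProj u₀)).source) :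
    extChartAt (frameModel m) u₀ u = frameCoord (frameProj u₀) u := by
  have h : extChartAt (frameModel m) u₀ u = extChartAt (frameModel m) u₀.1 u.1 := rfl
  rw [h, FiberBundle.extChartAt]
  simp only [PartialEquiv.trans_apply]
  change ((extChartAt (𝓡 m) u₀.1.1).prod (PartialEquiv.refl _))
    (trivializationAt (RSpace m →L[ℝ] RSpace m)
      (fun x : M => Trivial M (RSpace m) x →L[ℝ] TangentSpace (𝓡 m) x) u₀.1.1 u.1) = _
  rw [hom_trivializationAt_apply]
  refine Prod.ext rfl (ContinuousLinearMap.ext fun w => ?_)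
  change ContinuousLinearMap.inCoordinates _ _ _ _ _ _ _ _ u.1.2 w = _
  rw [ContinuousLinearMap.inCoordinates]
  simp only [Trivial.fiberBundle_trivializationAt', Trivial.symmL_trivialization,
    ContinuousLinearMap.comp_id, ContinuousLinearMap.coe_comp, Function.comp_apply]
  refine Eq.trans ?_ (trivializationAt_tangent_snd (I := 𝓡 m) hu (frameMap u w))
  rw [Trivialization.continuousLinearMapAt_apply, Trivialization.coe_linearMapAt_of_mem _ hu]
  rfl

theorem mem_chartAt_frameProj (u : FrameBundle m M) :
    frameProj u ∈ (chartAt (RSpace m) (frameProj u)).source := mem_chart_source _ _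

theorem contMDiffAt_extChartAt_frameBundle {u₀ u : FrameBundle m M}
    (hu : frameProj u ∈ (chartAt (RSpace m) (frameProj u₀)).source) :
    ContMDiffAt (frameModel m) 𝓘(ℝ, RSpace m × (RSpace m →L[ℝ] RSpace m)) ∞
      (extChartAt (frameModel m) u₀) u :=
  contMDiffAt_extChartAt' (by
    rw [← extChartAt_source (I := frameModel m)]
    exact mem_extChartAt_frameBundle_source.2 hu)

theorem contMDiff_frameProj : ContMDiff (frameModel m) (𝓡 m) ∞ (frameProj : FrameBundle m M → M) :=
  (contMDiff_proj (IB := 𝓡 m) (n := ∞)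
    (fun x : M => Trivial M (RSpace m) x →L[ℝ] TangentSpace (𝓡 m) x)).comp contMDiff_subtype_val

theorem eventually_mem_chartAt_frameProj {u₀ u : FrameBundle m M}
    (hu : frameProj u ∈ (chartAt (RSpace m) (frameProj u₀)).source) :
    ∀ᶠ v in 𝓝 u, frameProj v ∈ (chartAt (RSpace m) (frameProj u₀)).source :=
  contMDiff_frameProj.continuous.continuousAt.eventually_mem
    ((chartAt (RSpace m) (frameProj u₀)).open_source.mem_nhds hu)

/-- In coordinates the action is (x, p)·a = (x, p∘a). The base point does not move, so one chart
serves both for u and for u·a. -/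
theorem contMDiff_frameAction : ContMDiff ((frameModel m).prod (glModel m)) (frameModel m) ∞
    (fun p : FrameBundle m M × GLGroup m => p.1 <• p.2) := by
  rintro ⟨u₀, a₀⟩
  have hu₀ := mem_chartAt_frameProj u₀
  set κ := extChartAt (frameModel m) (u₀ <• a₀) with hκ
  let g : FrameBundle m M × GLGroup m → RSpace m × (RSpace m →L[ℝ] RSpace m) :=
    fun p => ((κ p.1).1, (κ p.1).2 ∘L (p.2 : RSpace m →L[ℝ] RSpace m))
  have hκs : ContMDiffAt ((frameModel m).prod (glModel m))
      𝓘(ℝ, RSpace m × (RSpace m →L[ℝ] RSpace m)) ∞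
      (fun p : FrameBundle m M × GLGroup m => κ p.1) (u₀, a₀) :=
    ContMDiffAt.comp (u₀, a₀)
      (contMDiffAt_extChartAt_frameBundle (u₀ := u₀ <• a₀) (u := u₀) hu₀) contMDiffAt_fst
  have hval : ContMDiffAt ((frameModel m).prod (glModel m)) 𝓘(ℝ, RSpace m →L[ℝ] RSpace m) ∞
      (fun p : FrameBundle m M × GLGroup m => (p.2 : RSpace m →L[ℝ] RSpace m)) (u₀, a₀) :=
    ContMDiffAt.comp (u₀, a₀) (Units.contMDiff_val.contMDiffAt) contMDiffAt_snd
  have hg : ContMDiffAt ((frameModel m).prod (glModel m))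
      𝓘(ℝ, RSpace m × (RSpace m →L[ℝ] RSpace m)) ∞ g (u₀, a₀) := by
    refine ContMDiffAt.prodMk_space ?_ (ContMDiffAt.clm_comp ?_ hval)
    · exact (ContinuousLinearMap.fst ℝ (RSpace m)
        (RSpace m →L[ℝ] RSpace m)).contMDiff.contMDiffAt.comp (u₀, a₀) hκs
    · exact (ContinuousLinearMap.snd ℝ (RSpace m)
        (RSpace m →L[ℝ] RSpace m)).contMDiff.contMDiffAt.comp (u₀, a₀) hκs
  have hκg : ∀ p : FrameBundle m M × GLGroup m,
      frameProj p.1 ∈ (chartAt (RSpace m) (frameProj u₀)).source → κ (p.1 <• p.2) = g p := by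
    intro p hp
    have h1 : κ (p.1 <• p.2) = frameCoord (frameProj (u₀ <• a₀)) (p.1 <• p.2) :=
      extChartAt_frameBundle_apply hp
    have h2 : κ p.1 = frameCoord (frameProj (u₀ <• a₀)) p.1 := extChartAt_frameBundle_apply hp
    rw [h1, frameCoord_smul, ← h2]
  have hsymm : ContMDiffAt 𝓘(ℝ, RSpace m × (RSpace m →L[ℝ] RSpace m)) (frameModel m) ∞ κ.symm
      (g (u₀, a₀)) := by
    refine (contMDiffOn_extChartAt_symm (u₀ <• a₀)).contMDiffAt
      ((isOpen_extChartAt_target _).mem_nhds ?_)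
    rw [← hκg (u₀, a₀) hu₀]
    exact mem_extChartAt_target _
  refine (hsymm.comp (u₀, a₀) hg).congr_of_eventuallyEq ?_
  have hev : ∀ᶠ p : FrameBundle m M × GLGroup m in 𝓝 (u₀, a₀),
      frameProj p.1 ∈ (chartAt (RSpace m) (frameProj u₀)).source :=
    continuousAt_fst.eventually (eventually_mem_chartAt_frameProj hu₀)
  filter_upwards [hev] with p hp
  rw [Function.comp_apply, ← hκg p hp, κ.left_inv (x := p.1 <• p.2)
    (mem_extChartAt_frameBundle_source.2 hp)]

theorem hasMFDerivAt_units_val (a : GLGroup m) :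
    HasMFDerivAt (glModel m) 𝓘(ℝ, RSpace m →L[ℝ] RSpace m)
      (fun b : GLGroup m => (b : RSpace m →L[ℝ] RSpace m)) a
      (ContinuousLinearMap.id ℝ (RSpace m →L[ℝ] RSpace m)) := by
  have h1 : (extChartAt (glModel m) a : GLGroup m → (RSpace m →L[ℝ] RSpace m)) =
      fun b : GLGroup m => (b : RSpace m →L[ℝ] RSpace m) := rfl
  have h2 : HasMFDerivAt (glModel m) 𝓘(ℝ, RSpace m →L[ℝ] RSpace m) (extChartAt (glModel m) a) a
      (mfderiv (glModel m) 𝓘(ℝ, RSpace m →L[ℝ] RSpace m) (extChartAt (glModel m) a) a) :=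
    (mdifferentiableAt_extChartAt (mem_chart_source _ a)).hasMFDerivAt
  rw [mfderiv_extChartAt_self] at h2
  exact h2

theorem mdifferentiableAt_extChartAt_frameBundle {u₀ u : FrameBundle m M}
    (hu : frameProj u ∈ (chartAt (RSpace m) (frameProj u₀)).source) :
    HasMFDerivAt (frameModel m) 𝓘(ℝ, RSpace m × (RSpace m →L[ℝ] RSpace m))
      (extChartAt (frameModel m) u₀) u (mfderiv (frameModel m)
        𝓘(ℝ, RSpace m × (RSpace m →L[ℝ] RSpace m)) (extChartAt (frameModel m) u₀) u) :=
  ((contMDiffAt_extChartAt_frameBundle hu).mdifferentiableAt (by simp)).hasMFDerivAt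

/-- Differentiate a ↦ (x, p∘a) at 1. Since p is invertible, this formula yields both the injectivity
of the fundamental vectors and the fact that they exhaust the vertical space. -/
theorem mfderiv_extChartAt_fundamentalVector {u₀ u : FrameBundle m M}
    (hu : frameProj u ∈ (chartAt (RSpace m) (frameProj u₀)).source)
    (C : RSpace m →L[ℝ] RSpace m) :
    (mfderiv (frameModel m) 𝓘(ℝ, RSpace m × (RSpace m →L[ℝ] RSpace m))
      (extChartAt (frameModel m) u₀) u (fundamentalVector (glModel m) (frameModel m)
        (G := GLGroup m) u C) :
        RSpace m × (RSpace m →L[ℝ] RSpace m)) =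
      ((0, (frameCoord (frameProj u₀) u).2 ∘L C) : RSpace m × (RSpace m →L[ℝ] RSpace m)) := by
  set κ := extChartAt (frameModel m) u₀ with hκ
  have h1 : HasMFDerivAt (frameModel m) 𝓘(ℝ, RSpace m × (RSpace m →L[ℝ] RSpace m)) κ
      (u <• (1 : GLGroup m)) (mfderiv (frameModel m)
        𝓘(ℝ, RSpace m × (RSpace m →L[ℝ] RSpace m)) κ u) := by
    rw [rightSmul_one]
    exact mdifferentiableAt_extChartAt_frameBundle hu
  have h2 := h1.comp (1 : GLGroup m) (hasMFDerivAt_orbitMap contMDiff_frameAction u)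
  let Λ : (RSpace m →L[ℝ] RSpace m) →L[ℝ] RSpace m × (RSpace m →L[ℝ] RSpace m) :=
    (0 : (RSpace m →L[ℝ] RSpace m) →L[ℝ] RSpace m).prod
      (ContinuousLinearMap.compL ℝ (RSpace m) (RSpace m) (RSpace m) (frameCoord (frameProj u₀) u).2)
  have h3 : HasFDerivAt (fun a : RSpace m →L[ℝ] RSpace m =>
      ((frameCoord (frameProj u₀) u).1, (frameCoord (frameProj u₀) u).2 ∘L a)) Λ
      ((1 : GLGroup m) : RSpace m →L[ℝ] RSpace m) :=
    (hasFDerivAt_const _ _).prodMk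
      (ContinuousLinearMap.compL ℝ (RSpace m) (RSpace m) (RSpace m)
        (frameCoord (frameProj u₀) u).2).hasFDerivAt
  have h4 := h3.hasMFDerivAt.comp (1 : GLGroup m) (hasMFDerivAt_units_val 1)
  have h5 : κ ∘ (fun a : GLGroup m => u <• a) = (fun a : RSpace m →L[ℝ] RSpace m =>
      ((frameCoord (frameProj u₀) u).1, (frameCoord (frameProj u₀) u).2 ∘L a)) ∘
      (fun a : GLGroup m => (a : RSpace m →L[ℝ] RSpace m)) :=
    funext fun a => extChartAt_frameBundle_apply (u := u <• a) hu
  rw [h5] at h2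
  exact DFunLike.congr_fun (hasMFDerivAt_unique h2 h4) C

theorem mfderiv_extChartAt_fst {u₀ u : FrameBundle m M}
    (hu : frameProj u ∈ (chartAt (RSpace m) (frameProj u₀)).source)
    (w : TangentSpace (frameModel m) u) :
    (mfderiv (frameModel m) 𝓘(ℝ, RSpace m × (RSpace m →L[ℝ] RSpace m))
      (extChartAt (frameModel m) u₀) u w : RSpace m × (RSpace m →L[ℝ] RSpace m)).1 =
    (mfderiv (𝓡 m) 𝓘(ℝ, RSpace m) (extChartAt (𝓡 m) (frameProj u₀)) (frameProj u)
      (mfderiv (frameModel m) (𝓡 m) frameProj u w) : RSpace m) := by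
  have h1 := ((ContinuousLinearMap.fst ℝ (RSpace m)
    (RSpace m →L[ℝ] RSpace m)).hasFDerivAt.hasMFDerivAt).comp u
      (mdifferentiableAt_extChartAt_frameBundle hu)
  have h2 := (mdifferentiableAt_extChartAt (I := 𝓡 m) hu).hasMFDerivAt.comp u
    (contMDiff_frameProj.mdifferentiable (by simp) u).hasMFDerivAt
  have h3 := h2.congr_of_eventuallyEq
    (f₁ := ContinuousLinearMap.fst ℝ (RSpace m) (RSpace m →L[ℝ] RSpace m) ∘
      extChartAt (frameModel m) u₀) (by
    filter_upwards [eventually_mem_chartAt_frameProj hu] with v hv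
    rw [Function.comp_apply, extChartAt_frameBundle_apply hv]
    rfl)
  exact DFunLike.congr_fun (hasMFDerivAt_unique h1 h3) w

theorem isInvertible_mfderiv_extChartAt_frameBundle {u₀ u : FrameBundle m M}
    (hu : frameProj u ∈ (chartAt (RSpace m) (frameProj u₀)).source) :
    (mfderiv (frameModel m) 𝓘(ℝ, RSpace m × (RSpace m →L[ℝ] RSpace m))
      (extChartAt (frameModel m) u₀) u).IsInvertible :=
  isInvertible_mfderiv_extChartAt (mem_extChartAt_frameBundle_source.2 hu)

theorem isInvertible_frameCoord_snd {x₀ : M} {u : FrameBundle m M}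
    (hu : frameProj u ∈ (chartAt (RSpace m) x₀).source) :
    (frameCoord x₀ u).2.IsInvertible :=
  (isInvertible_mfderiv_extChartAt (I := 𝓡 m) (by rwa [extChartAt_source])).comp u.2

theorem frame_fundamentalVector_injective (u : FrameBundle m M) :
    Function.Injective (fundamentalVector (glModel m) (frameModel m) (G := GLGroup m) u) := by
  intro A B hAB
  have hu := mem_chartAt_frameProj u
  have h1 := mfderiv_extChartAt_fundamentalVector (u₀ := u) hu A
  have h2 := mfderiv_extChartAt_fundamentalVector (u₀ := u) hu B
  rw [hAB] at h1
  have h3 := congrArg Prod.snd (h1.symm.trans h2)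
  obtain ⟨e, he⟩ := isInvertible_frameCoord_snd hu
  refine ContinuousLinearMap.ext fun x => e.injective ?_
  have h4 := DFunLike.congr_fun h3 x
  simp only [← he] at h4
  exact h4

theorem exists_frame_fundamentalVector_eq {u : FrameBundle m M} {w : TangentSpace (frameModel m) u}
    (hw : mfderiv (frameModel m) (𝓡 m) frameProj u w = 0) :
    ∃ A : GroupLieAlgebra (glModel m) (GLGroup m),
      fundamentalVector (glModel m) (frameModel m) u A = w := by
  have hu := mem_chartAt_frameProj u
  have h1 := mfderiv_extChartAt_fst (u₀ := u) hu w
  rw [hw] at h1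
  obtain ⟨e, he⟩ := isInvertible_frameCoord_snd hu
  set W : RSpace m × (RSpace m →L[ℝ] RSpace m) := mfderiv (frameModel m)
    𝓘(ℝ, RSpace m × (RSpace m →L[ℝ] RSpace m)) (extChartAt (frameModel m) u) u w with hW
  -- The equation p∘C = W₂ determines C; the first component of `W` vanishes because `w` is
  -- vertical.
  let C : RSpace m →L[ℝ] RSpace m := (e.symm : RSpace m →L[ℝ] RSpace m) ∘L W.2
  refine ⟨C, ?_⟩
  obtain ⟨ψ, hψ⟩ := isInvertible_mfderiv_extChartAt_frameBundle (u₀ := u) hu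
  have h2 := mfderiv_extChartAt_fundamentalVector (u₀ := u) hu C
  have h3 : ((0, (frameCoord (frameProj u) u).2 ∘L C) :
      RSpace m × (RSpace m →L[ℝ] RSpace m)) = W := by
    refine Prod.ext (Eq.symm ?_) ?_
    · rw [h1]; exact map_zero _
    · rw [← he]
      ext1 x
      simp [C]
  have h4 := h2.trans h3
  rw [hW, ← hψ] at h4
  exact ψ.injective h4

end FrameBundle

/-! ### The natural lift of a vector field -/

section NaturalLift

variable {m : ℕ} {M : Type*} [TopologicalSpace M] [ChartedSpace (RSpace m) M]
  [IsManifold (𝓡 m) ∞ M]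

attribute [local instance] frameSMul frameTopologicalSpace glTopologicalSpace frameChartedSpace
  glChartedSpace frameGLChartedSpace isManifold_frameBundle_one

/-- Precomposing with an isomorphism does not affect invertibility, so the two sides take the same
branch, and the dummy value is equivariant too. -/
theorem frameLift_smul (φ : M → M) (u : FrameBundle m M) (a : GLGroup m) :
    frameLift φ (u <• a) = frameLift φ u <• a := by
  have hiff : (mfderiv (𝓡 m) (𝓡 m) φ (frameProj (u <• a)) ∘L frameMap (u <• a)).IsInvertible ↔
      (mfderiv (𝓡 m) (𝓡 m) φ (frameProj u) ∘L frameMap u).IsInvertible :=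
    ContinuousLinearMap.isInvertible_comp_equiv
      (e := ContinuousLinearEquiv.unitsEquiv ℝ (RSpace m) a)
      (f := mfderiv (𝓡 m) (𝓡 m) φ (frameProj u) ∘L frameMap u)
  by_cases h : (mfderiv (𝓡 m) (𝓡 m) φ (frameProj u) ∘L frameMap u).IsInvertible
  · rw [frameLift, frameLift, dif_pos (hiff.2 h), dif_pos h]
    rfl
  · rw [frameLift, frameLift, dif_neg (mt hiff.1 h), dif_neg h]

variable [T2Space M] {ξ : (x : M) → TangentSpace (𝓡 m) x}

/-- The lifted flow reads (γ(t), A(t)∘p) in coordinates, with A the derivative of the flow. For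
small t the map A(t) is close to the identity, hence invertible, and `frameLift` is not at its dummy
value. The chart is centred at a separate `u₀` so that `u` can vary when smoothness is proved. -/
theorem hasMFDerivAt_frameLift_vectorFlow (hξ : IsSmoothVectorField (𝓡 m) ξ)
    {u₀ u : FrameBundle m M}
    (hu : frameProj u ∈ (chartAt (RSpace m) (frameProj u₀)).source) :
    frameLift (vectorFlow (𝓡 m) ξ 0) u = u ∧
    MDifferentiableAt 𝓘(ℝ, ℝ) (frameModel m)
      (fun t : ℝ => frameLift (vectorFlow (𝓡 m) ξ t) u) 0 ∧
    (mfderiv (frameModel m) 𝓘(ℝ, RSpace m × (RSpace m →L[ℝ] RSpace m))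
      (extChartAt (frameModel m) u₀) u (naturalLift ξ u) : RSpace m × (RSpace m →L[ℝ] RSpace m)) =
      (chartField ξ (frameProj u₀) (frameCoord (frameProj u₀) u).1,
        fderiv ℝ (chartField ξ (frameProj u₀)) (frameCoord (frameProj u₀) u).1 ∘L
          (frameCoord (frameProj u₀) u).2) := by
  set x₀ := frameProj u₀ with hx₀
  set κ := extChartAt (frameModel m) u₀ with hκ
  obtain ⟨γ, A, hγ0, hγ', hA0, hA', hev⟩ := exists_vectorFlow_chart hξ hu
  let K : ℝ → RSpace m × (RSpace m →L[ℝ] RSpace m) :=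
    fun t => (γ t, A t ∘L (frameCoord x₀ u).2)
  have hκu : κ u = frameCoord x₀ u := extChartAt_frameBundle_apply hu
  have hK0 : K 0 = κ u := by
    rw [hκu]
    refine Prod.ext hγ0 ?_
    change A 0 ∘L (frameCoord x₀ u).2 = _
    rw [hA0, ContinuousLinearMap.id_comp]
  have hK' : HasDerivAt K (chartField ξ x₀ (frameCoord x₀ u).1,
      fderiv ℝ (chartField ξ x₀) (frameCoord x₀ u).1 ∘L (frameCoord x₀ u).2) 0 :=
    hγ'.prodMk ((hA'.clm_comp (hasDerivAt_const (0 : ℝ) (frameCoord x₀ u).2)).congr_deriv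
      (by rw [ContinuousLinearMap.comp_zero, add_zero]; rfl))
  have hinv : ∀ᶠ t in 𝓝 (0 : ℝ), (A t).IsInvertible := by
    have h1 : range ((↑) : (RSpace m ≃L[ℝ] RSpace m) → (RSpace m →L[ℝ] RSpace m)) ∈ 𝓝 (A 0) :=
      ContinuousLinearEquiv.isOpen.mem_nhds
        (by rw [hA0]; exact ⟨ContinuousLinearEquiv.refl ℝ (RSpace m), rfl⟩)
    exact hA'.continuousAt.eventually_mem h1
  have hlift : ∀ᶠ t in 𝓝 (0 : ℝ),
      frameLift (vectorFlow (𝓡 m) ξ t) u ∈ κ.source ∧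
      κ (frameLift (vectorFlow (𝓡 m) ξ t) u) = K t := by
    filter_upwards [hev, hinv] with t ht htA
    obtain ⟨hγt, hflow, hder⟩ := ht
    have hy : vectorFlow (𝓡 m) ξ t (frameProj u) ∈ (chartAt (RSpace m) x₀).source := by
      rw [hflow, ← extChartAt_source (I := 𝓡 m)]
      exact (extChartAt (𝓡 m) x₀).map_target hγt
    obtain ⟨e, he⟩ := isInvertible_mfderiv_extChartAt (I := 𝓡 m) (x := x₀)
      (y := vectorFlow (𝓡 m) ξ t (frameProj u)) (by rwa [extChartAt_source])
    have hcomp : mfderiv (𝓡 m) 𝓘(ℝ, RSpace m) (extChartAt (𝓡 m) x₀)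
        (vectorFlow (𝓡 m) ξ t (frameProj u)) ∘L
        (mfderiv (𝓡 m) (𝓡 m) (vectorFlow (𝓡 m) ξ t) (frameProj u) ∘L frameMap u) =
        A t ∘L (frameCoord x₀ u).2 :=
      congrArg (fun T : TangentSpace (𝓡 m) (frameProj u) →L[ℝ] RSpace m => T ∘L frameMap u) hder
    have hframe : (mfderiv (𝓡 m) (𝓡 m) (vectorFlow (𝓡 m) ξ t) (frameProj u) ∘L
        frameMap u).IsInvertible := by
      have h1 := htA.comp (isInvertible_frameCoord_snd (x₀ := x₀) hu)
      rw [← hcomp, ← he] at h1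
      exact ContinuousLinearMap.isInvertible_equiv_comp.1 h1
    have hl : frameLift (vectorFlow (𝓡 m) ξ t) u = ⟨⟨vectorFlow (𝓡 m) ξ t (frameProj u),
        mfderiv (𝓡 m) (𝓡 m) (vectorFlow (𝓡 m) ξ t) (frameProj u) ∘L frameMap u⟩, hframe⟩ := by
      rw [frameLift, dif_pos hframe]
    have hp : frameProj (frameLift (vectorFlow (𝓡 m) ξ t) u) ∈ (chartAt (RSpace m) x₀).source := by
      rw [hl]; exact hy
    refine ⟨mem_extChartAt_frameBundle_source.2 hp, ?_⟩
    rw [hκ, extChartAt_frameBundle_apply hp, hl]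
    refine Prod.ext ?_ hcomp
    change extChartAt (𝓡 m) x₀ (vectorFlow (𝓡 m) ξ t (frameProj u)) = γ t
    rw [hflow, (extChartAt (𝓡 m) x₀).right_inv hγt]
  have hsymm : ∀ᶠ t in 𝓝 (0 : ℝ), frameLift (vectorFlow (𝓡 m) ξ t) u = κ.symm (K t) := by
    filter_upwards [hlift] with t ht
    rw [← ht.2, κ.left_inv (x := frameLift (vectorFlow (𝓡 m) ξ t) u) ht.1]
  have h0 : frameLift (vectorFlow (𝓡 m) ξ 0) u = u := by
    rw [hsymm.self_of_nhds, hK0, κ.left_inv (x := u) (mem_extChartAt_frameBundle_source.2 hu)]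
  have hd : MDifferentiableAt 𝓘(ℝ, ℝ) (frameModel m)
      (fun t : ℝ => frameLift (vectorFlow (𝓡 m) ξ t) u) 0 := by
    have htgt : K 0 ∈ κ.target := by
      rw [hK0]
      exact κ.map_source (x := u) (mem_extChartAt_frameBundle_source.2 hu)
    have h1 := (hasMFDerivAt_extChartAt_symm (I := frameModel m) htgt).comp (0 : ℝ)
      hK'.hasFDerivAt.hasMFDerivAt
    exact (h1.congr_of_eventuallyEq hsymm).mdifferentiableAt
  refine ⟨h0, hd, ?_⟩
  have h1 : HasMFDerivAt (frameModel m) 𝓘(ℝ, RSpace m × (RSpace m →L[ℝ] RSpace m)) κ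
      (frameLift (vectorFlow (𝓡 m) ξ 0) u) (mfderiv (frameModel m)
        𝓘(ℝ, RSpace m × (RSpace m →L[ℝ] RSpace m)) κ u) := by
    rw [h0]
    exact mdifferentiableAt_extChartAt_frameBundle hu
  have h2 := h1.comp (0 : ℝ) hd.hasMFDerivAt
  have h3 := hK'.hasFDerivAt.hasMFDerivAt.congr_of_eventuallyEq
    (f₁ := κ ∘ fun t : ℝ => frameLift (vectorFlow (𝓡 m) ξ t) u) (by
      filter_upwards [hlift] with t ht using ht.2)
  have h4 := DFunLike.congr_fun (hasMFDerivAt_unique h2 h3) (1 : ℝ)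
  refine Eq.trans h4 ?_
  exact one_smul ℝ _

/-- Right translations commute with the lift of every map; differentiate at t = 0. -/
theorem naturalLift_smul (hξ : IsSmoothVectorField (𝓡 m) ξ) (u : FrameBundle m M) (a : GLGroup m) :
    mfderiv (frameModel m) (frameModel m) (fun v : FrameBundle m M => v <• a) u (naturalLift ξ u) =
      naturalLift ξ (u <• a) := by
  obtain ⟨h0, hd, -⟩ := hasMFDerivAt_frameLift_vectorFlow hξ (u₀ := u) (mem_chartAt_frameProj u)
  have h1 : HasMFDerivAt (frameModel m) (frameModel m) (fun v : FrameBundle m M => v <• a)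
      (frameLift (vectorFlow (𝓡 m) ξ 0) u)
      (mfderiv (frameModel m) (frameModel m) (fun v : FrameBundle m M => v <• a) u) := by
    rw [h0]
    exact hasMFDerivAt_rightTranslation contMDiff_frameAction a u
  have h2 := h1.comp (0 : ℝ) hd.hasMFDerivAt
  have h3 : (fun v : FrameBundle m M => v <• a) ∘
      (fun t : ℝ => frameLift (vectorFlow (𝓡 m) ξ t) u) =
      fun t : ℝ => frameLift (vectorFlow (𝓡 m) ξ t) (u <• a) :=
    funext fun t => (frameLift_smul _ u a).symm
  rw [h3] at h2
  exact (DFunLike.congr_fun h2.mfderiv (1 : ℝ)).symm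

theorem mfderiv_frameProj_naturalLift (hξ : IsSmoothVectorField (𝓡 m) ξ) (u : FrameBundle m M) :
    mfderiv (frameModel m) (𝓡 m) frameProj u (naturalLift ξ u) = ξ (frameProj u) := by
  have hu := mem_chartAt_frameProj u
  obtain ⟨-, -, h1⟩ := hasMFDerivAt_frameLift_vectorFlow hξ (u₀ := u) hu
  have h2 := (mfderiv_extChartAt_fst (u₀ := u) hu (naturalLift ξ u)).symm.trans
    (congrArg Prod.fst h1)
  obtain ⟨e, he⟩ := isInvertible_mfderiv_extChartAt (I := 𝓡 m) (mem_extChartAt_source (frameProj u))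
  have h3 := h2.trans (chartField_extChartAt (I := 𝓡 m) ξ hu)
  rw [← he] at h3
  exact e.injective h3

/-- Near `u₀` the lift is the pullback by the chart of (x, p) ↦ (v(x), Dv(x)∘p), which is smooth
since v is. -/
theorem isSmoothVectorField_naturalLift (hξ : IsSmoothVectorField (𝓡 m) ξ) :
    IsSmoothVectorField (frameModel m) (naturalLift ξ : (u : FrameBundle m M) → _) := by
  intro u₀
  have hu₀ := mem_chartAt_frameProj u₀
  let V : (p : RSpace m × (RSpace m →L[ℝ] RSpace m)) →
      TangentSpace 𝓘(ℝ, RSpace m × (RSpace m →L[ℝ] RSpace m)) p := fun p =>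
    ((chartField ξ (frameProj u₀) p.1, fderiv ℝ (chartField ξ (frameProj u₀)) p.1 ∘L p.2) :
      RSpace m × (RSpace m →L[ℝ] RSpace m))
  have hV : ContMDiffAt 𝓘(ℝ, RSpace m × (RSpace m →L[ℝ] RSpace m))
      𝓘(ℝ, RSpace m × (RSpace m →L[ℝ] RSpace m)).tangent ∞
      (fun p => (⟨p, V p⟩ : TangentBundle 𝓘(ℝ, RSpace m × (RSpace m →L[ℝ] RSpace m)) _))
      (extChartAt (frameModel m) u₀ u₀) := by
    rw [contMDiffAt_vectorSpace_iff_contDiffAt]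
    have hmem : (extChartAt (frameModel m) u₀ u₀).1 ∈ (extChartAt (𝓡 m) (frameProj u₀)).target := by
      rw [extChartAt_frameBundle_apply hu₀]
      exact mem_extChartAt_target (frameProj u₀)
    have h1 : ContDiffAt ℝ ∞ (chartField ξ (frameProj u₀)) (extChartAt (frameModel m) u₀ u₀).1 :=
      (contDiffOn_chartField hξ (frameProj u₀)).contDiffAt
        ((isOpen_extChartAt_target _).mem_nhds hmem)
    have h2 : ContDiffAt ℝ ∞ (fderiv ℝ (chartField ξ (frameProj u₀)))
        (extChartAt (frameModel m) u₀ u₀).1 := h1.fderiv_right (by simp)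
    exact (h1.comp (extChartAt (frameModel m) u₀ u₀) contDiffAt_fst).prodMk
      ((h2.comp (extChartAt (frameModel m) u₀ u₀) contDiffAt_fst).clm_comp contDiffAt_snd)
  have hpull := hV.mpullback_vectorField_preimage (n := ∞)
    (contMDiffAt_extChartAt_frameBundle hu₀) (isInvertible_mfderiv_extChartAt_frameBundle hu₀)
    (by simp)
  refine hpull.congr_of_eventuallyEq ?_
  filter_upwards [eventually_mem_chartAt_frameProj hu₀] with u hu
  obtain ⟨-, -, h1⟩ := hasMFDerivAt_frameLift_vectorFlow hξ hu
  refine congrArg (fun w : TangentSpace (frameModel m) u =>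
    (⟨u, w⟩ : TangentBundle (frameModel m) (FrameBundle m M))) ?_
  rw [VectorField.mpullback_apply]
  refine (((isInvertible_mfderiv_extChartAt_frameBundle hu).inverse_apply_eq).2 ?_).symm
  refine Eq.trans ?_ h1.symm
  rw [← extChartAt_frameBundle_apply hu]

end NaturalLift

theorem isInvertible_of_bijective {E F : Type*} [NormedAddCommGroup E] [NormedSpace ℝ E]
    [CompleteSpace E] [NormedAddCommGroup F] [NormedSpace ℝ F] [CompleteSpace F] {T : E →L[ℝ] F}
    (hT : Function.Bijective T) : T.IsInvertible :=
  ⟨ContinuousLinearEquiv.ofBijective T (LinearMap.ker_eq_bot.2 hT.1)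
    (LinearMap.range_eq_top.2 hT.2), by ext x; rfl⟩

/-! ### Morphisms of extensions of vector spaces -/

section Linear

variable {V' 𝔤' V 𝔤 B : Type*} [AddCommGroup V'] [Module ℝ V'] [AddCommGroup 𝔤'] [Module ℝ 𝔤']
  [AddCommGroup V] [Module ℝ V] [AddCommGroup 𝔤] [Module ℝ 𝔤] [AddCommGroup B] [Module ℝ B]
  {F' : 𝔤' →ₗ[ℝ] V'} {p' : V' →ₗ[ℝ] B} {F : 𝔤 →ₗ[ℝ] V} {p : V →ₗ[ℝ] B} {j : V' →ₗ[ℝ] V}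
  {φ : 𝔤' →ₗ[ℝ] 𝔤} {𝔪 : Submodule ℝ 𝔤}

/-- A morphism `(φ, j)` of extensions over `B` identifies `V` with `V' ⊕ F 𝔪`, if `𝔪` is a
complement of the image of `φ`: injectivity. -/
theorem eq_zero_of_extension_hom (hker' : ∀ v, p' v = 0 → ∃ A, F' A = v)
    (hF : Function.Injective F) (hpF : ∀ A, p (F A) = 0) (hpj : ∀ v, p (j v) = p' v)
    (hjF : ∀ A, j (F' A) = F (φ A)) (hφ : Function.Injective φ)
    (hdisj : Disjoint (LinearMap.range φ) 𝔪) {v : V'} {A : 𝔤} (hA : A ∈ 𝔪)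
    (h : j v + F A = 0) : v = 0 ∧ A = 0 := by
  -- Applying `p` shows that `v` is vertical, v = F'C. Then φC = -A lies in both summands, so it is
  -- zero.
  have h1 : p' v = 0 := by
    rw [← hpj, eq_neg_of_add_eq_zero_left h, map_neg, hpF, neg_zero]
  obtain ⟨C, rfl⟩ := hker' v h1
  rw [hjF, ← map_add] at h
  have h2 : φ C + A = 0 := hF (h.trans (map_zero F).symm)
  have h3 : φ C ∈ 𝔪 := by
    rw [eq_neg_of_add_eq_zero_left h2]
    exact 𝔪.neg_mem hA
  have h4 : φ C = 0 := Submodule.disjoint_def.1 hdisj _ ⟨C, rfl⟩ h3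
  have h5 : C = 0 := hφ (h4.trans (map_zero φ).symm)
  rw [h4, zero_add] at h2
  exact ⟨by rw [h5, map_zero], h2⟩

/-- A morphism `(φ, j)` of extensions over `B` identifies `V` with `V' ⊕ F 𝔪`, if `𝔪` is a
complement of the image of `φ`: surjectivity. -/
theorem exists_eq_of_extension_hom (hsurj : Function.Surjective p')
    (hker : ∀ w, p w = 0 → ∃ A, F A = w) (hpj : ∀ v, p (j v) = p' v)
    (hjF : ∀ A, j (F' A) = F (φ A)) (hcodisj : Codisjoint (LinearMap.range φ) 𝔪) (w : V) :
    ∃ v, ∃ A ∈ 𝔪, j v + F A = w := by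
  obtain ⟨v, hv⟩ := hsurj (p w)
  -- A lift of `p w` misses `w` by a vertical vector FC. Splitting C = φD + A, the first part is
  -- absorbed into the lift.
  obtain ⟨C, hC⟩ := hker (w - j v) (by rw [map_sub, hpj, hv, sub_self])
  obtain ⟨_, A, ⟨D, rfl⟩, hA, hDA⟩ := Submodule.codisjoint_iff_exists_add_eq.1 hcodisj C
  refine ⟨v + F' D, A, hA, ?_⟩
  rw [map_add, hjF, add_assoc, ← map_add, hDA, hC, add_sub_cancel]

end Linear

/-! ### The derivative of the action -/

section Action

variable {EG HG EP HP : Type*}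
  [NormedAddCommGroup EG] [NormedSpace ℝ EG] [TopologicalSpace HG]
  [NormedAddCommGroup EP] [NormedSpace ℝ EP] [TopologicalSpace HP]
  {IG : ModelWithCorners ℝ EG HG} {IP : ModelWithCorners ℝ EP HP}
  {G : Type*} [TopologicalSpace G] [ChartedSpace HG G] [Group G]
  {P : Type*} [TopologicalSpace P] [ChartedSpace HP P] [MulAction Gᵐᵒᵖ P]

/-- The derivative of the action at `(u, 1)`. -/
theorem hasMFDerivAt_action_one
    (hact : ContMDiff (IP.prod IG) IP ∞ (fun p : P × G => p.1 <• p.2)) (u : P)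
    {T : EG →L[ℝ] EP} (hT : HasMFDerivAt IG IP (fun a : G => u <• a) 1 T) {a : G} (ha : a = 1) :
    HasMFDerivAt (IP.prod IG) IP (fun p : P × G => p.1 <• p.2) (u, a)
      ((ContinuousLinearMap.id ℝ EP).coprod T) := by
  subst ha
  have h := (hact.mdifferentiable (by simp) (u, (1 : G))).hasMFDerivAt
  -- A linear map on a product is determined by its restrictions to the factors: here the orbit map
  -- of `u` and the translation by 1.
  have h1 := hasMFDerivAt_unique (h.comp (1 : G)
    ((hasMFDerivAt_const u (1 : G)).prodMk (hasMFDerivAt_id (1 : G)))) hT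
  have h2 := h.comp u ((hasMFDerivAt_id u).prodMk (hasMFDerivAt_const (1 : G) u))
  rw [show (fun p : P × G => p.1 <• p.2) ∘ (fun v : P => (id v, (1 : G))) = id from
    funext fun v => rightSmul_one v] at h2
  have h3 := hasMFDerivAt_unique h2 (hasMFDerivAt_id u)
  refine h.congr_mfderiv ?_
  set D : EP × EG →L[ℝ] EP := mfderiv (IP.prod IG) IP (fun p : P × G => p.1 <• p.2) (u, 1)
  change D = (ContinuousLinearMap.id ℝ EP).coprod T
  refine ContinuousLinearMap.ext fun w => ?_
  have h4 : D (w.1, 0) = w.1 := DFunLike.congr_fun h3 w.1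
  have h5 : D (0, w.2) = T w.2 := DFunLike.congr_fun h1 w.2
  rw [ContinuousLinearMap.coprod_apply, ← h5, ContinuousLinearMap.id_apply]
  conv_rhs => rw [← h4]
  rw [← map_add]
  simp

end Action

/-! ### Lifting vector fields along a Γ-structure -/

section GammaStructure

variable {EM HM EG HG EP HP EG' HG' EP' HP' : Type*}
  [NormedAddCommGroup EM] [NormedSpace ℝ EM] [TopologicalSpace HM]
  [NormedAddCommGroup EG] [NormedSpace ℝ EG] [TopologicalSpace HG]
  [NormedAddCommGroup EP] [NormedSpace ℝ EP] [TopologicalSpace HP]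
  [NormedAddCommGroup EG'] [NormedSpace ℝ EG'] [TopologicalSpace HG']
  [NormedAddCommGroup EP'] [NormedSpace ℝ EP'] [TopologicalSpace HP']
  {IM : ModelWithCorners ℝ EM HM} {IG : ModelWithCorners ℝ EG HG} {IP : ModelWithCorners ℝ EP HP}
  {IG' : ModelWithCorners ℝ EG' HG'} {IP' : ModelWithCorners ℝ EP' HP'}
  {M : Type*} [TopologicalSpace M] [ChartedSpace HM M]
  {G : Type*} [TopologicalSpace G] [ChartedSpace HG G] [Group G]
  {P : Type*} [TopologicalSpace P] [ChartedSpace HP P] [MulAction Gᵐᵒᵖ P]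
  {G' : Type*} [TopologicalSpace G'] [ChartedSpace HG' G'] [Group G']
  {P' : Type*} [TopologicalSpace P'] [ChartedSpace HP' P'] [MulAction G'ᵐᵒᵖ P']
  {pr : P → M} {pr' : P' → M} {ρ : G' →* G} {ζ : P' → P}

/-- A morphism of principal bundles whose group homomorphism is a local isomorphism is itself a
local diffeomorphism. -/
theorem IsPrincipalHom.mfderiv_bijective [LieGroup IG ∞ G] [LieGroup IG' ∞ G']
    (hP : IsPrincipalBundle IM IG IP G pr)
    (hP' : IsPrincipalBundle IM IG' IP' G' pr') (hζ : IsPrincipalHom IG' IP' IG IP pr' pr ρ ζ)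
    (hρ : Function.Bijective (lieMap IG' IG ρ)) (u : P') :
    Function.Bijective (mfderiv IP' IP ζ u) := by
  -- As ρ_* is onto, the zero subspace is a complement of its image, so both diagram chases apply
  -- with 𝔪 = 0.
  have hrange : LinearMap.range (lieMap IG' IG ρ).toLinearMap = ⊤ :=
    LinearMap.range_eq_top.2 hρ.2
  constructor
  · rw [injective_iff_map_eq_zero]
    intro v hv
    refine (eq_zero_of_extension_hom (V := EP) (B := EM) (v := v) (A := 0)
      (F' := (fundamentalVector IG' IP' u).toLinearMap)
      (p' := (mfderiv IP' IM pr' u).toLinearMap)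
      (F := (fundamentalVector IG IP (ζ u)).toLinearMap)
      (p := (mfderiv IP IM pr (ζ u)).toLinearMap)
      (j := (mfderiv IP' IP ζ u).toLinearMap) (φ := (lieMap IG' IG ρ).toLinearMap)
      (fun v hv => hP'.exists_fundamentalVector_eq hv) (hP.fundamentalVector_injective _)
      (fun A => mfderiv_fundamentalVector_eq_zero hP.smooth_action hP.smooth_proj hP.proj_smul _ A)
      (fun v => hζ.mfderiv_mfderiv hP.smooth_proj u v)
      (fun A => hζ.mfderiv_fundamentalVector hP'.smooth_action hP.smooth_action u A) hρ.1
      (𝔪 := ⊥) disjoint_bot_right (Submodule.zero_mem _) ?_).1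
    exact (congrArg₂ (fun a b : EP => a + b) hv
      (map_zero (fundamentalVector IG IP (G := G) (ζ u)))).trans (add_zero (0 : EP))
  · intro w
    obtain ⟨v, A, hA, h⟩ := exists_eq_of_extension_hom (V := EP) (B := EM)
      (F' := (fundamentalVector IG' IP' u).toLinearMap)
      (p' := (mfderiv IP' IM pr' u).toLinearMap)
      (F := (fundamentalVector IG IP (ζ u)).toLinearMap)
      (p := (mfderiv IP IM pr (ζ u)).toLinearMap)
      (j := (mfderiv IP' IP ζ u).toLinearMap) (φ := (lieMap IG' IG ρ).toLinearMap)
      (hP'.mfderiv_proj_surjective u)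
      (fun w hw => hP.exists_fundamentalVector_eq hw)
      (fun v => hζ.mfderiv_mfderiv hP.smooth_proj u v)
      (fun A => hζ.mfderiv_fundamentalVector hP'.smooth_action hP.smooth_action u A)
      (𝔪 := ⊥) (by rw [hrange]; exact codisjoint_top_left) w
    obtain rfl := (Submodule.mem_bot ℝ).1 hA
    exact ⟨v, Eq.trans ((congrArg (fun z : EP => HAdd.hAdd (α := EP) (mfderiv IP' IP ζ u v) z)
      (map_zero (fundamentalVector IG IP (G := G) (ζ u)))).trans (add_zero _)).symm h⟩

/-- A vector field lifts uniquely along a morphism of principal bundles that is a local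
diffeomorphism, and the lift inherits smoothness and invariance. -/
theorem exists_lift_of_mfderiv_bijective [IsManifold IP ∞ P] [IsManifold IP' ∞ P']
    [CompleteSpace EP] [CompleteSpace EP']
    (hP : IsPrincipalBundle IM IG IP G pr)
    (hP' : IsPrincipalBundle IM IG' IP' G' pr') (hζ : IsPrincipalHom IG' IP' IG IP pr' pr ρ ζ)
    (hbij : ∀ u, Function.Bijective (mfderiv IP' IP ζ u)) {X : (u : P) → TangentSpace IP u}
    (hX : IsSmoothVectorField IP X) (hXinv : IsInvariantVectorField IP G X) :
    ∃ X' : (u : P') → TangentSpace IP' u,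
      IsSmoothVectorField IP' X' ∧ ProjectsOnto IP' IP ζ X' X ∧
      IsInvariantVectorField IP' G' X' ∧
      ∀ η : (u : P') → TangentSpace IP' u, ProjectsOnto IP' IP ζ η X → η = X' := by
  have : IsManifold IP 1 P := IsManifold.of_le (n := ∞) (by simp)
  have : IsManifold IP' 1 P' := IsManifold.of_le (n := ∞) (by simp)
  have hinv : ∀ u, (mfderiv IP' IP ζ u).IsInvertible := fun u =>
    isInvertible_of_bijective (E := EP') (F := EP) (hbij u)
  have hproj : ProjectsOnto IP' IP ζ (VectorField.mpullback IP' IP ζ X) X := fun u =>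
    (((hinv u).inverse_apply_eq).1 rfl).symm
  refine ⟨VectorField.mpullback IP' IP ζ X,
    hX.mpullback_vectorField (n := ∞) hζ.smooth hinv (by simp), hproj, fun a u => ?_,
    fun η hη => funext fun u => (hbij u).1 ((hη u).trans (hproj u).symm)⟩
  -- Invariance is checked after applying the injective Tζ, where it becomes invariance of `X` under
  -- `ρ a`.
  refine (hbij (u <• a)).1 ?_
  have h1 := hζ.mfderiv_rightTranslation hP'.smooth_action hP.smooth_action a u
    (VectorField.mpullback IP' IP ζ X u)
  rw [hproj u] at h1
  refine h1.trans (Eq.trans (hXinv (ρ a) (ζ u)) ?_)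
  refine Eq.trans ?_ (hproj (u <• a)).symm
  exact congrArg (fun q : P => (X q : EP)) (hζ.equivariant u a).symm

end GammaStructure

/-! ### Existence, uniqueness and smoothness of the Kosmann field -/

section Kosmann

variable {EM HM EG HG EP HP EK HK EQ HQ : Type*}
  [NormedAddCommGroup EM] [NormedSpace ℝ EM] [TopologicalSpace HM]
  [NormedAddCommGroup EG] [NormedSpace ℝ EG] [TopologicalSpace HG]
  [NormedAddCommGroup EP] [NormedSpace ℝ EP] [TopologicalSpace HP]
  [NormedAddCommGroup EK] [NormedSpace ℝ EK] [TopologicalSpace HK]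
  [NormedAddCommGroup EQ] [NormedSpace ℝ EQ] [TopologicalSpace HQ]
  {IM : ModelWithCorners ℝ EM HM} {IG : ModelWithCorners ℝ EG HG} {IP : ModelWithCorners ℝ EP HP}
  {IK : ModelWithCorners ℝ EK HK} {IQ : ModelWithCorners ℝ EQ HQ}

/-- Every tangent space is the derivative of a local parametrization. -/
theorem exists_parametrization {M : Type*} [TopologicalSpace M] [ChartedSpace HM M]
    [IsManifold IM ∞ M] [IM.Boundaryless] (x : M) :
    ∃ σ : EM → M, σ 0 = x ∧ ContMDiffAt 𝓘(ℝ, EM) IM ∞ σ 0 ∧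
      HasMFDerivAt 𝓘(ℝ, EM) IM σ 0 (ContinuousLinearMap.id ℝ EM) := by
  have : IsManifold IM 1 M := IsManifold.of_le (n := ∞) (by simp)
  set c := extChartAt IM x with hc
  let L : EM →L[ℝ] EM := mfderiv IM 𝓘(ℝ, EM) c x
  -- Inserting the derivative `L` of the chart makes the derivative of the parametrization at 0 the
  -- identity.
  let τ : EM → EM := fun A => c x + L A
  have hτ0 : τ 0 = c x := by simp [τ]
  have hmem : τ 0 ∈ c.target := by rw [hτ0]; exact mem_extChartAt_target x
  have hτ : HasMFDerivAt 𝓘(ℝ, EM) 𝓘(ℝ, EM) τ 0 L :=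
    (L.hasFDerivAt.const_add (c x)).hasMFDerivAt
  have hτs : ContMDiffAt 𝓘(ℝ, EM) 𝓘(ℝ, EM) ∞ τ 0 :=
    (contDiffAt_const.add L.contDiff.contDiffAt).contMDiffAt
  have h1 : ContMDiffAt 𝓘(ℝ, EM) IM ∞ c.symm (τ 0) :=
    (contMDiffOn_extChartAt_symm (n := ∞) x).contMDiffAt
      ((isOpen_extChartAt_target x).mem_nhds hmem)
  refine ⟨c.symm ∘ τ, ?_, h1.comp 0 hτs, ?_⟩
  · rw [Function.comp_apply, hτ0]
    exact extChartAt_to_inv x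
  · refine ((hasMFDerivAt_extChartAt_symm (I := IM) (x₀ := x) hmem).comp 0 hτ).congr_mfderiv ?_
    have h2 := mfderivWithin_extChartAt_symm_comp_mfderiv_extChartAt' (I := IM)
      (mem_extChartAt_source x)
    rw [IM.range_eq_univ, mfderivWithin_univ] at h2
    refine Eq.trans ?_ h2
    rw [hτ0]
    rfl

variable {M : Type*} [TopologicalSpace M] [ChartedSpace HM M]
  {G : Type*} [TopologicalSpace G] [ChartedSpace HG G] [Group G]
  {P : Type*} [TopologicalSpace P] [ChartedSpace HP P] [MulAction Gᵐᵒᵖ P]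
  {K : Type*} [TopologicalSpace K] [ChartedSpace HK K] [Group K]
  {Q : Type*} [TopologicalSpace Q] [ChartedSpace HQ Q] [MulAction Kᵐᵒᵖ Q]
  {pr : P → M} {prQ : Q → M} {f : G →* K} {i : P → Q}
  {𝔪 : Submodule ℝ (GroupLieAlgebra IK K)}

/-- A smooth map `Ψ` whose derivative along `P × 0` is `(v, A) ↦ T i v + A^*`. -/
theorem exists_transverse_parametrization [LieGroup IK ∞ K] [IK.Boundaryless] (𝔫 : Submodule ℝ EK)
    (hact : ContMDiff (IQ.prod IK) IQ ∞ (fun p : Q × K => p.1 <• p.2))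
    (hi : ContMDiff IP IQ ∞ i) :
    ∃ Ψ : P × 𝔫 → Q, ∀ u : P, Ψ (u, 0) = i u ∧
      ContMDiffAt (IP.prod 𝓘(ℝ, 𝔫)) IQ ∞ Ψ (u, 0) ∧
      ∀ (v : EP) (A : 𝔫), (mfderiv (IP.prod 𝓘(ℝ, 𝔫)) IQ Ψ (u, 0) (v, A) : EQ) =
        HAdd.hAdd (α := EQ) (β := EQ) (mfderiv IP IQ i u v)
          (fundamentalVector IK IQ (G := K) (i u) (A : EK)) := by
  obtain ⟨σ, hσ1, hσs, hσ⟩ := exists_parametrization (IM := IK) (1 : K)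
  let ι : 𝔫 →L[ℝ] EK := 𝔫.subtypeL
  have hι0 : ι 0 = 0 := map_zero ι
  have hι : HasMFDerivAt 𝓘(ℝ, 𝔫) 𝓘(ℝ, EK) ι 0 ι := ι.hasFDerivAt.hasMFDerivAt
  have hιs : ContMDiffAt 𝓘(ℝ, 𝔫) 𝓘(ℝ, EK) ∞ ι 0 := ι.contDiff.contDiffAt.contMDiffAt
  rw [← hι0] at hσ hσs
  have hσι := hσ.comp 0 hι
  have hσιs := hσs.comp 0 hιs
  have hσι0 : (σ ∘ ι) 0 = 1 := by rw [Function.comp_apply, hι0, hσ1]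
  -- The parametrization `σ` of the group at 1 serves as an exponential map to first order, which is
  -- all that is needed.
  refine ⟨fun p => i p.1 <• (σ ∘ ι) p.2, fun u => ⟨?_, ?_, fun v A => ?_⟩⟩
  · change i u <• (σ ∘ ι) 0 = i u
    rw [hσι0, rightSmul_one]
  · have h1 : ContMDiffAt (IP.prod 𝓘(ℝ, 𝔫)) IQ ∞ (fun p : P × 𝔫 => i p.1) (u, 0) :=
      hi.contMDiffAt.comp _ contMDiffAt_fst
    have h2 : ContMDiffAt (IP.prod 𝓘(ℝ, 𝔫)) IK ∞ (fun p : P × 𝔫 => (σ ∘ ι) p.2) (u, 0) :=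
      ContMDiffAt.comp (u, (0 : 𝔫)) (g := σ ∘ ι) (f := Prod.snd) hσιs contMDiffAt_snd
    exact hact.contMDiffAt.comp (u, (0 : 𝔫)) (h1.prodMk h2)
  · have h1 := (hi.mdifferentiable (by simp) u).hasMFDerivAt.comp (u, (0 : 𝔫))
      (hasMFDerivAt_fst (I := IP) (I' := 𝓘(ℝ, 𝔫)) (u, (0 : 𝔫)))
    have h2 := HasMFDerivAt.comp (u, (0 : 𝔫)) (g := σ ∘ ι) (f := Prod.snd) hσι
      (hasMFDerivAt_snd (I := IP) (I' := 𝓘(ℝ, 𝔫)) (u, (0 : 𝔫)))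
    have h3 := (hasMFDerivAt_action_one hact (i u) (hasMFDerivAt_orbitMap hact (i u))
      hσι0).comp (u, (0 : 𝔫)) (h1.prodMk h2)
    exact DFunLike.congr_fun h3.mfderiv (v, A)

theorem isKosmannField_iff {Ξ : (q : Q) → TangentSpace IQ q} {η : (u : P) → TangentSpace IP u} :
    IsKosmannField IK IP IQ 𝔪 i Ξ η ↔
      ∀ u, ∃ A ∈ 𝔪, HAdd.hAdd (α := EQ) (β := EQ) (mfderiv IP IQ i u (η u))
        (fundamentalVector IK IQ (i u) A) = Ξ (i u) := by
  refine forall_congr' fun u => ⟨?_, ?_⟩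
  · rintro ⟨A, hA, h⟩
    refine ⟨A, hA, ?_⟩
    change (mfderiv IP IQ i u (η u) : EQ) + fundamentalVector IK IQ (i u) A = (Ξ (i u) : EQ)
    rw [show (fundamentalVector IK IQ (i u) A : EQ) = (Ξ (i u) : EQ) - mfderiv IP IQ i u (η u)
      from h]
    exact add_sub_cancel (G := EQ) _ _
  · rintro ⟨A, hA, h⟩
    exact ⟨A, hA, eq_sub_of_add_eq' (G := EQ) h⟩

/-- The tangent space of the big bundle is the direct sum of that of the reduced bundle and of
the transverse space. -/
theorem IsPrincipalHom.bijective_add_fundamentalVector [LieGroup IG ∞ G]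
    (hP : IsPrincipalBundle IM IG IP G pr)
    (hact : ContMDiff (IQ.prod IK) IQ ∞ (fun p : Q × K => p.1 <• p.2))
    (hpr : ContMDiff IQ IM ∞ prQ) (hinv : ∀ (q : Q) (a : K), prQ (q <• a) = prQ q)
    (hinj : ∀ q : Q, Function.Injective (fundamentalVector IK IQ (G := K) q))
    (hker : ∀ (q : Q) (w : TangentSpace IQ q), mfderiv IQ IM prQ q w = 0 →
      ∃ A : GroupLieAlgebra IK K, fundamentalVector IK IQ q A = w)
    (hi : IsPrincipalHom IG IP IK IQ pr prQ f i)
    (hf : Function.Injective (lieMap IG IK f)) (h𝔪 : IsReductiveSplitting IG IK f 𝔪) (u : P) :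
    Function.Bijective (fun w : EP × 𝔪 => HAdd.hAdd (α := EQ) (β := EQ) (mfderiv IP IQ i u w.1)
      (fundamentalVector IK IQ (i u) (w.2 : GroupLieAlgebra IK K))) := by
  let S : EP × 𝔪 →ₗ[ℝ] EQ := LinearMap.coprod (M := EP) (M₂ := 𝔪) (M₃ := EQ)
    (mfderiv IP IQ i u).toLinearMap
    ((fundamentalVector IK IQ (i u)).toLinearMap.comp 𝔪.subtype)
  have hS : Function.Bijective S := by
    constructor
    · rw [injective_iff_map_eq_zero]
      intro w hw
      have := eq_zero_of_extension_hom (V := EQ) (B := EM) (v := w.1) (A := (w.2.1 : EK))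
        (F' := (fundamentalVector IG IP u).toLinearMap)
        (p' := (mfderiv IP IM pr u).toLinearMap)
        (F := (fundamentalVector IK IQ (i u)).toLinearMap)
        (p := (mfderiv IQ IM prQ (i u)).toLinearMap)
        (j := (mfderiv IP IQ i u).toLinearMap) (φ := (lieMap IG IK f).toLinearMap)
        (fun v hv => hP.exists_fundamentalVector_eq hv) (hinj _)
        (fun A => mfderiv_fundamentalVector_eq_zero hact hpr hinv _ A)
        (fun v => hi.mfderiv_mfderiv hpr u v)
        (fun A => hi.mfderiv_fundamentalVector hP.smooth_action hact u A) hf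
        (𝔪 := 𝔪) h𝔪.isCompl.disjoint w.2.2 hw
      exact Prod.ext this.1 (Subtype.ext this.2)
    · intro w
      obtain ⟨v, A, hA, h⟩ := exists_eq_of_extension_hom (V := EQ) (B := EM)
        (F' := (fundamentalVector IG IP u).toLinearMap)
        (p' := (mfderiv IP IM pr u).toLinearMap)
        (F := (fundamentalVector IK IQ (i u)).toLinearMap)
        (p := (mfderiv IQ IM prQ (i u)).toLinearMap)
        (j := (mfderiv IP IQ i u).toLinearMap) (φ := (lieMap IG IK f).toLinearMap)
        (hP.mfderiv_proj_surjective u) (hker (i u))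
        (fun v => hi.mfderiv_mfderiv hpr u v)
        (fun A => hi.mfderiv_fundamentalVector hP.smooth_action hact u A)
        (𝔪 := 𝔪) h𝔪.isCompl.codisjoint w
      exact ⟨(v, ⟨A, hA⟩), h⟩
  exact hS

/-- An invariant smooth vector field along a reductive reduction has a unique generalized Kosmann
field, which is smooth and invariant. -/
theorem exists_kosmannField [LieGroup IK ∞ K] [IsManifold IP ∞ P] [IsManifold IQ ∞ Q]
    [FiniteDimensional ℝ EK]
    [CompleteSpace EP] [CompleteSpace EQ] [IK.Boundaryless]
    (hP : IsPrincipalBundle IM IG IP G pr)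
    (hact : ContMDiff (IQ.prod IK) IQ ∞ (fun p : Q × K => p.1 <• p.2))
    (hi : IsPrincipalHom IG IP IK IQ pr prQ f i) (h𝔪 : IsReductiveSplitting IG IK f 𝔪)
    (hbij : ∀ u, Function.Bijective (fun w : EP × 𝔪 => HAdd.hAdd (α := EQ) (β := EQ)
      (mfderiv IP IQ i u w.1) (fundamentalVector IK IQ (i u) (w.2 : GroupLieAlgebra IK K))))
    {Ξ : (q : Q) → TangentSpace IQ q} (hΞ : IsSmoothVectorField IQ Ξ)
    (hΞinv : IsInvariantVectorField IQ K Ξ) :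
    ∃ ΞK : (u : P) → TangentSpace IP u, IsKosmannField IK IP IQ 𝔪 i Ξ ΞK ∧
      (∀ η : (u : P) → TangentSpace IP u, IsKosmannField IK IP IQ 𝔪 i Ξ η → η = ΞK) ∧
      IsSmoothVectorField IP ΞK ∧ IsInvariantVectorField IP G ΞK := by
  have : IsManifold IP 1 P := IsManifold.of_le (n := ∞) (by simp)
  have : IsManifold IQ 1 Q := IsManifold.of_le (n := ∞) (by simp)
  choose w hw using fun u => (hbij u).2 (Ξ (i u))
  -- Uniqueness of the decomposition, used both against competing sections and for invariance.
  have hwu : ∀ (u : P) (v : EP) (A : EK), A ∈ 𝔪 → HAdd.hAdd (α := EQ) (β := EQ)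
      (mfderiv IP IQ i u v) (fundamentalVector IK IQ (i u) A) = Ξ (i u) → v = (w u).1 :=
    fun u v A hA h =>
      congrArg Prod.fst ((hbij u).1 (a₁ := ((v, ⟨A, hA⟩) : EP × 𝔪)) (h.trans (hw u).symm))
  refine ⟨fun u => (w u).1, isKosmannField_iff.2 fun u => ⟨(w u).2, (w u).2.2, hw u⟩,
    fun η hη => funext fun u => ?_, fun u => ?_, fun a u => ?_⟩
  · obtain ⟨A, hA, h⟩ := isKosmannField_iff.1 hη u
    exact hwu u _ A hA h
  -- Smoothness: `Ξ` is pulled back along `Ψ`, defined on P × 𝔪, and restricted to P × 0, where its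
  -- P-component is the Kosmann field. Viewing 𝔪 inside the model space `EK` gives the factor its
  -- normed structure.
  · let 𝔫 : Submodule ℝ EK := 𝔪
    obtain ⟨Ψ, hΨ⟩ := exists_transverse_parametrization 𝔫 hact hi.smooth
    have hinv : ∀ u, (mfderiv (IP.prod 𝓘(ℝ, 𝔫)) IQ Ψ (u, 0)).IsInvertible := fun u => by
      have he : ∀ w : EP × 𝔫, (mfderiv (IP.prod 𝓘(ℝ, 𝔫)) IQ Ψ (u, 0) w : EQ) =
          HAdd.hAdd (α := EQ) (β := EQ) (mfderiv IP IQ i u w.1)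
            (fundamentalVector IK IQ (i u) (w.2 : EK)) := fun w => (hΨ u).2.2 w.1 w.2
      refine isInvertible_of_bijective (E := EP × 𝔫) (F := EQ)
        ⟨fun w w' h => (hbij u).1 ((he w).symm.trans (h.trans (he w'))), fun z => ?_⟩
      obtain ⟨w, hw⟩ := (hbij u).2 z
      exact ⟨w, (he w).trans hw⟩
    let Y := VectorField.mpullback (IP.prod 𝓘(ℝ, 𝔫)) IQ Ψ Ξ
    have hY : ∀ u, (Y (u, 0) : EP × 𝔫) = w u := fun u => by
      have h1 : (mfderiv (IP.prod 𝓘(ℝ, 𝔫)) IQ Ψ (u, 0) (Y (u, 0)) : EQ) = Ξ (Ψ (u, 0)) :=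
        (((hinv u).inverse_apply_eq).1 rfl).symm
      have h2 : (Ξ (Ψ (u, 0)) : EQ) = Ξ (i u) := congrArg (fun q => (Ξ q : EQ)) (hΨ u).1
      exact (hbij u).1 ((((hΨ u).2.2 (Y (u, 0)).1 (Y (u, 0)).2).symm.trans (h1.trans h2)).trans
        (hw u).symm)
    have hYs : ContMDiffAt (IP.prod 𝓘(ℝ, 𝔫)) (IP.prod 𝓘(ℝ, 𝔫)).tangent ∞
        (fun p => (⟨p, Y p⟩ : TangentBundle (IP.prod 𝓘(ℝ, 𝔫)) (P × 𝔫))) (u, 0) :=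
      ContMDiffAt.mpullback_vectorField_preimage (n := ∞) (hΞ (Ψ (u, 0))) (hΨ u).2.1 (hinv u)
        (by simp)
    have h3 : ContMDiffAt IP (IP.prod 𝓘(ℝ, 𝔫)).tangent ∞
        (fun v => (⟨(v, 0), Y (v, 0)⟩ : TangentBundle (IP.prod 𝓘(ℝ, 𝔫)) (P × 𝔫))) u :=
      ContMDiffAt.comp u (f := fun v : P => (v, (0 : 𝔫))) hYs
        (contMDiffAt_id.prodMk contMDiffAt_const)
    have h4 : ContMDiff (IP.prod 𝓘(ℝ, 𝔫)).tangent IP.tangent ∞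
        (tangentMap (IP.prod 𝓘(ℝ, 𝔫)) IP (Prod.fst : P × 𝔫 → P)) :=
      (contMDiff_fst (n := ∞)).contMDiff_tangentMap (by simp)
    refine (h4.contMDiffAt.comp u h3).congr_of_eventuallyEq (.of_forall fun v => ?_)
    refine congrArg (fun z : EP => (⟨v, z⟩ : TangentBundle IP P)) ?_
    rw [mfderiv_fst]
    exact (congrArg Prod.fst (hY v)).symm
  -- Translating the decomposition at `u` by `f a` gives one at `u <• a`, whose second term is again
  -- transverse because 𝔪 is Ad-invariant.
  · refine hwu (u <• a) _ (lieAd IK (f a)⁻¹ (w u).2) ?_ ?_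
    · rw [← map_inv]
      exact h𝔪.ad_mem a⁻¹ _ (w u).2.2
    · have h1 := hi.mfderiv_rightTranslation hP.smooth_action hact a u (w u).1
      have h2 := mfderiv_rightTranslation_fundamentalVector hact (f a) (i u) (w u).2
      have h3 : i (u <• a) = i u <• f a := hi.equivariant u a
      have h4 : (fundamentalVector IK IQ (i (u <• a)) (lieAd IK (f a)⁻¹ (w u).2) : EQ) =
          fundamentalVector IK IQ (i u <• f a) (lieAd IK (f a)⁻¹ (w u).2) :=
        congrArg (fun q => (fundamentalVector IK IQ q (lieAd IK (f a)⁻¹ (w u).2) : EQ)) h3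
      have h5 : (Ξ (i (u <• a)) : EQ) = Ξ (i u <• f a) := congrArg (fun q => (Ξ q : EQ)) h3
      have h6 := hΞinv (f a) (i u)
      refine (congrArg₂ (fun x y : EQ => x + y) h1 (h4.trans h2.symm)).trans
        (Eq.trans ?_ (h6.trans h5.symm))
      refine Eq.trans (map_add (mfderiv IQ IQ (fun v : Q => v <• f a) (i u)) _ _).symm ?_
      exact congrArg (mfderiv IQ IQ (fun v : Q => v <• f a) (i u)) (hw u)

/-- The transverse component is vertical, so it is lost in the projection. -/
theorem IsKosmannField.projectsOnto {Ξ : (q : Q) → TangentSpace IQ q}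
    {η : (u : P) → TangentSpace IP u} {ξ : (x : M) → TangentSpace IM x}
    (hη : IsKosmannField IK IP IQ 𝔪 i Ξ η) (hΞ : ProjectsOnto IQ IM prQ Ξ ξ)
    (hact : ContMDiff (IQ.prod IK) IQ ∞ (fun p : Q × K => p.1 <• p.2))
    (hpr : ContMDiff IQ IM ∞ prQ) (hinv : ∀ (q : Q) (a : K), prQ (q <• a) = prQ q)
    (hi : IsPrincipalHom IG IP IK IQ pr prQ f i) : ProjectsOnto IP IM pr η ξ := by
  intro u
  obtain ⟨A, hA, h⟩ := isKosmannField_iff.1 hη u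
  have h1 := mfderiv_fundamentalVector_eq_zero hact hpr hinv (i u) A
  have h2 : (mfderiv IQ IM prQ (i u) (Ξ (i u)) : EM) = mfderiv IQ IM prQ (i u)
      (mfderiv IP IQ i u (η u)) := by
    rw [← h]
    refine (map_add (mfderiv IQ IM prQ (i u)) _ _).trans ?_
    exact (congrArg (fun z : EM => HAdd.hAdd (α := EM) (mfderiv IQ IM prQ (i u)
      (mfderiv IP IQ i u (η u))) z) h1).trans (add_zero _)
  refine (hi.mfderiv_mfderiv hpr u (η u)).symm.trans (h2.symm.trans ((hΞ (i u)).trans ?_))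
  exact congrArg (fun x => (ξ x : EM)) (hi.proj_comp u)

end Kosmann

end

theorem mainTheorem4 (m : ℕ)
    -- the base manifold
    (M : Type*) [TopologicalSpace M] [T2Space M] [ChartedSpace (RSpace m) M]
    [IsManifold (𝓡 m) ∞ M]
    -- the Lie groups `G` and `Γ`
    {EG HG EΓ HΓ : Type*}
    [NormedAddCommGroup EG] [NormedSpace ℝ EG] [FiniteDimensional ℝ EG] [TopologicalSpace HG]
    (IG : ModelWithCorners ℝ EG HG) [IG.Boundaryless]
    (G : Type*) [TopologicalSpace G] [ChartedSpace HG G] [Group G] [LieGroup IG ∞ G]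
    [NormedAddCommGroup EΓ] [NormedSpace ℝ EΓ] [FiniteDimensional ℝ EΓ] [TopologicalSpace HΓ]
    (IΓ : ModelWithCorners ℝ EΓ HΓ) [IΓ.Boundaryless]
    (Γ : Type*) [TopologicalSpace Γ] [SecondCountableTopology Γ]
    [ChartedSpace HΓ Γ] [Group Γ] [LieGroup IΓ ∞ Γ]
    -- the principal bundles `P` and `P'` over `M`
    {EP HP EP' HP' : Type*}
    [NormedAddCommGroup EP] [NormedSpace ℝ EP] [FiniteDimensional ℝ EP] [TopologicalSpace HP]
    (IP : ModelWithCorners ℝ EP HP) [IP.Boundaryless]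
    (P : Type*) [TopologicalSpace P] [ChartedSpace HP P] [IsManifold IP ∞ P] [MulAction Gᵐᵒᵖ P]
    (pr : P → M) (hP : IsPrincipalBundle (𝓡 m) IG IP G pr)
    [NormedAddCommGroup EP'] [NormedSpace ℝ EP'] [FiniteDimensional ℝ EP'] [TopologicalSpace HP']
    (IP' : ModelWithCorners ℝ EP' HP') [IP'.Boundaryless]
    (P' : Type*) [TopologicalSpace P'] [ChartedSpace HP' P'] [IsManifold IP' ∞ P']
    [MulAction Γᵐᵒᵖ P']
    (pr' : P' → M) (hP' : IsPrincipalBundle (𝓡 m) IΓ IP' Γ pr')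
    -- `P` is a classical `G`-structure: a reductive `G`-structure on the frame bundle
    (f : G →* GLGroup m) (i : P → FrameBundle m M)
    (hi : IsReduction IG IP (glModel m) (frameModel m) pr frameProj f i)
    (𝔪 : Submodule ℝ (GroupLieAlgebra (glModel m) (GLGroup m)))
    (h𝔪 : IsReductiveSplitting IG (glModel m) f 𝔪)
    -- `ζ : P' → P` is a `Γ`-structure
    (ρ : Γ →* G) (ζ : P' → P)
    (hζ : IsGammaStructure IΓ IP' IG IP pr' pr ρ ζ)
    -- a vector field on `M`
    (ξ : (x : M) → TangentSpace (𝓡 m) x) (hξ : IsSmoothVectorField (𝓡 m) ξ) :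
    -- the generalized Kosmann lift of `ξ` exists and is unique, smooth, `G`-invariant, over `ξ`
    ∃ ξK : (u : P) → TangentSpace IP u,
      IsKosmannField (glModel m) IP (frameModel m) 𝔪 i (naturalLift ξ) ξK ∧
      (∀ η : (u : P) → TangentSpace IP u,
        IsKosmannField (glModel m) IP (frameModel m) 𝔪 i (naturalLift ξ) η → η = ξK) ∧
      IsSmoothVectorField IP ξK ∧ IsInvariantVectorField IP G ξK ∧
      ProjectsOnto IP (𝓡 m) pr ξK ξ ∧
      -- and it lifts to a unique vector field on `P'`, which is `Γ`-invariant
      ∃ ξK' : (u : P') → TangentSpace IP' u,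
        IsSmoothVectorField IP' ξK' ∧ ProjectsOnto IP' IP ζ ξK' ξK ∧
        IsInvariantVectorField IP' Γ ξK' ∧
        ∀ η : (u : P') → TangentSpace IP' u, ProjectsOnto IP' IP ζ η ξK → η = ξK' := by
  have : CompleteSpace EP := FiniteDimensional.complete ℝ EP
  have : CompleteSpace EP' := FiniteDimensional.complete ℝ EP'
  have : CompleteSpace EG := FiniteDimensional.complete ℝ EG
  have : IsManifold (frameModel m) 1 (FrameBundle m M) := isManifold_frameBundle_one
  -- A trivial kernel is discrete, which makes `lieMap_injective` applicable to `f`.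
  have hfker : Subsingleton f.ker := by
    rw [(MonoidHom.ker_eq_bot_iff f).2 hi.injective_group]
    infer_instance
  have hfinj := lieMap_injective (IG := glModel m) (IG' := IG) hi.smooth_group
  obtain ⟨ξK, hξK, huniq, hsmooth, hinv⟩ := exists_kosmannField hP contMDiff_frameAction
    hi.toIsPrincipalHom h𝔪
    (hi.toIsPrincipalHom.bijective_add_fundamentalVector hP contMDiff_frameAction
      contMDiff_frameProj frameProj_smul frame_fundamentalVector_injective
      (fun _ _ => exists_frame_fundamentalVector_eq) hfinj h𝔪)
    (isSmoothVectorField_naturalLift hξ) (fun a u => naturalLift_smul hξ u a)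
  have := hζ.discrete_ker
  refine ⟨ξK, hξK, huniq, hsmooth, hinv, hξK.projectsOnto
    (fun u => mfderiv_frameProj_naturalLift hξ u) contMDiff_frameAction contMDiff_frameProj
    frameProj_smul hi.toIsPrincipalHom, exists_lift_of_mfderiv_bijective hP hP'
    hζ.toIsPrincipalHom (hζ.toIsPrincipalHom.mfderiv_bijective hP hP'
      (lieMap_bijective hζ.smooth_group hζ.surjective_group)) hsmooth hinv⟩
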